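/- **Setting.** A *commutative monoidal category* is a commutative monoid object in $\mathsf{Cat}$ (small categories), i.e. a strict monoidal category with $a\otimes b=b\otimes a$ and $f\otimes g=g\otimes f$ for all objects $a,b$ and morphisms $f,g$. Let $\mathsf{CMC}$ be the category of commutative monoidal categories and strict monoidal functors. A *Petri net* is a pair of functions $s,t\colon T\to\mathbb N[S]$, where $\mathbb N[S]$ is the free commutative monoid on the set $S$; a morphism $(s,t\colon T\to\mathbb N[S])\to(s',t'\colon T'\to\mathbb N[S'])$ is a pair of functions $f\colon T\to T'$, $g\colon S\to S'$ with $s'f=\mathbb N[g]s$ and $t'f=\mathbb N[g]t$. Let $F\colon\mathsf{Petri}\to\mathsf{CMC}$ send a Petri net to the commutative monoidal category with $\mathbb N[S]$ as its monoid of objects and with morphisms freely generated by the transitions $\tau\colon s(\tau)\to t(\tau)$ under identities, composition and $+$, modulo the laws of a commutative monoidal category. Let $L\colon\mathsf{Set}\to\mathsf{Petri}$ send $X$ to the Petri net with set of places $X$ and no transitions, and let $L'=FL\colon\mathsf{Set}\to\mathsf{CMC}$. A *double category* means a pseudo double category (a category weakly internal to $\mathsf{Cat}$), and a *symmetric monoidal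 double category* is a symmetric pseudomonoid in the 2-category of double categories, (pseudo) double functors and transformations, whose source and target functors are strict symmetric monoidal and whose category of arrows has as monoidal unit the horizontal identity on the monoidal unit. **Theorem.** The category $\mathsf{CMC}$ has finite colimits, the functor $L'$ is a left adjoint, and there is a symmetric monoidal double category $\mathbb{O}\mathbf{pen}(\mathsf{CMC})$ for which: - objects are sets and vertical 1-morphisms are functions, with the usual composition; - horizontal 1-cells from $X$ to $Y$ are *open commutative monoidal categories*, i.e. cospans $L'X\xrightarrow{\,i\,}C\xleftarrow{\,o\,}L'Y$ in $\mathsf{CMC}$; - 2-morphisms from $L'X\xrightarrow{i}C\xleftarrow{o}L'Y$ to $L'X'\xrightarrow{i'}C'\xleftarrow{o'}L'Y'$ with sides $f\colon X\to X'$ and $g\colon Y\to Y'$ are morphisms $\alpha\colon C\to C'$ in $\mathsf{CMC}$ with $\alpha i=i'L'(f)$ and $\alpha o=o'L'(g)$; they are composed vertically by composing $f$, $g$ and $\alpha$ in $\mathsf{Set}$ and $\mathsf{CMC}$; - the horizontal identity on $X$ is $L'X\xrightarrow{1}L'X\xleftarrow{1}L'X$, and on $f$ it is $L'(f)$; the horizontal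 composite of $L'X\xrightarrow{i_1}C\xleftarrow{o_1}L'Y$ and $L'Y\xrightarrow{i_2}D\xleftarrow{o_2}L'Z$ is the cospan $L'X\to C+_{L'Y}D\leftarrow L'Z$ given by a chosen pushout, and the horizontal composite of 2-morphisms $\alpha$, $\beta$ with common side $g$ is $\alpha+_{L'g}\beta$; - the tensor product is given by chosen coproducts in $\mathsf{Set}$ and $\mathsf{CMC}$: $X\otimes X'=X+X'$ and $f\otimes f'=f+f'$; the tensor product of $L'X\xrightarrow{i}C\xleftarrow{o}L'Y$ and $L'X'\xrightarrow{i'}C'\xleftarrow{o'}L'Y'$ is $C+C'$ with legs $L'(X+X')\cong L'X+L'X'\xrightarrow{i+i'}C+C'$ and $L'(Y+Y')\cong L'Y+L'Y'\xrightarrow{o+o'}C+C'$; the tensor product of 2-morphisms is $\alpha+\alpha'$; the unit object is the initial object, and the symmetry is the canonical isomorphism $C+C'\cong C'+C$; - all other structure isomorphisms (associators and unitors of horizontal composition and of the tensor product, and the comparisons that make the tensor product a double functor) are the canonical ones determined by the universal properties of pushouts and coproducts. -/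

import Mathlib

open CategoryTheory CategoryTheory.Limits MonoidalCategory

universe u v w u₀ v₀ u₁ v₁

/-! ### Commutative monoidal categories and Petri nets -/

/-- The category `CMC`: commutative monoid objects in `Cat` (small categories whose objects and
whose morphisms form commutative monoids, functorially) and strict monoidal functors, i.e. functors
that commute strictly with the tensor product and the unit. -/
abbrev CMC : Type (u + 1) := CommMon Cat.{u, u}

/-- A Petri net `s, t : T → ℕ[S]`.  The free commutative monoid `ℕ[S]` is the monoid of finite
multisets of elements of `S`. -/
structure PetriNet where
  transition : Type u
  place : Type u
  source : transition → Multiset place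
  target : transition → Multiset place

namespace PetriNet

/-- A morphism of Petri nets: a function on transitions and a function on places that are
compatible with sources and targets. -/
@[ext]
structure Hom (P Q : PetriNet.{u}) where
  onTransition : P.transition → Q.transition
  onPlace : P.place → Q.place
  source_eq : ∀ τ, Q.source (onTransition τ) = (P.source τ).map onPlace
  target_eq : ∀ τ, Q.target (onTransition τ) = (P.target τ).map onPlace

instance : Category PetriNet.{u} where
  Hom := Hom
  id P := ⟨_root_.id, _root_.id, fun τ => by simp, fun τ => by simp⟩
  comp f g := ⟨g.onTransition ∘ f.onTransition, g.onPlace ∘ f.onPlace,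
    fun τ => by simp [f.source_eq, g.source_eq], fun τ => by simp [f.target_eq, g.target_eq]⟩

/-- The formal morphisms generated by the transitions of `P`. -/
inductive Raw (P : PetriNet.{u}) : Multiset P.place → Multiset P.place → Type u
  | gen (τ : P.transition) : Raw P (P.source τ) (P.target τ)
  | idn (a : Multiset P.place) : Raw P a a
  | add {a b a' b' : Multiset P.place} (f : Raw P a b) (g : Raw P a' b') :
      Raw P (a + a') (b + b')
  | cmp {a b c : Multiset P.place} (f : Raw P a b) (g : Raw P b c) : Raw P a c

/-- The equivalence relation on formal morphisms that imposes the laws of a commutative monoidal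
category.  It relates formal morphisms with arbitrary ends, because the two sides of a law such as
`f + g = g + f` have ends that are equal, but not by definition. -/
inductive Rel (P : PetriNet.{u}) : ∀ {a b a' b' : Multiset P.place},
    Raw P a b → Raw P a' b' → Prop
  | refl {a b} (f : Raw P a b) : Rel P f f
  | symm {a b a' b'} {f : Raw P a b} {g : Raw P a' b'} : Rel P f g → Rel P g f
  | trans {a b a' b' a'' b''} {f : Raw P a b} {g : Raw P a' b'} {h : Raw P a'' b''} :
      Rel P f g → Rel P g h → Rel P f h
  | cmp_congr {a b c a' b' c'} {f : Raw P a b} {g : Raw P b c} {f' : Raw P a' b'}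
      {g' : Raw P b' c'} : Rel P f f' → Rel P g g' → Rel P (f.cmp g) (f'.cmp g')
  | add_congr {a b c d a' b' c' d'} {f : Raw P a b} {g : Raw P c d} {f' : Raw P a' b'}
      {g' : Raw P c' d'} : Rel P f f' → Rel P g g' → Rel P (f.add g) (f'.add g')
  | idn_cmp {a b} (f : Raw P a b) : Rel P ((Raw.idn a).cmp f) f
  | cmp_idn {a b} (f : Raw P a b) : Rel P (f.cmp (Raw.idn b)) f
  | cmp_assoc {a b c d} (f : Raw P a b) (g : Raw P b c) (h : Raw P c d) :
      Rel P ((f.cmp g).cmp h) (f.cmp (g.cmp h))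
  | add_idn (a b : Multiset P.place) :
      Rel P ((Raw.idn a).add (Raw.idn b)) (Raw.idn (a + b))
  | add_cmp {a b c a' b' c'} (f : Raw P a b) (g : Raw P b c) (f' : Raw P a' b')
      (g' : Raw P b' c') : Rel P ((f.cmp g).add (f'.cmp g')) ((f.add f').cmp (g.add g'))
  | add_assoc {a b a' b' a'' b''} (f : Raw P a b) (g : Raw P a' b') (h : Raw P a'' b'') :
      Rel P ((f.add g).add h) (f.add (g.add h))
  | add_comm {a b a' b'} (f : Raw P a b) (g : Raw P a' b') : Rel P (f.add g) (g.add f)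
  | zero_add {a b} (f : Raw P a b) : Rel P ((Raw.idn 0).add f) f

theorem Rel.ends {P : PetriNet.{u}} {a b a' b' : Multiset P.place} {f : Raw P a b}
    {g : Raw P a' b'} (h : Rel P f g) : a = a' ∧ b = b' := by
  induction h with
  | add_assoc => exact ⟨_root_.add_assoc _ _ _, _root_.add_assoc _ _ _⟩
  | add_comm => exact ⟨_root_.add_comm _ _, _root_.add_comm _ _⟩
  | _ => simp_all

/-- The objects of the free commutative monoidal category `FP`. -/
structure FreeCMC (P : PetriNet.{u}) : Type u where
  marking : Multiset P.place

/-- The morphisms of `FP`: formal morphisms modulo the laws of a commutative monoidal category. -/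
def FreeHom (P : PetriNet.{u}) (a b : Multiset P.place) : Type u :=
  Quot (fun f g : Raw P a b => Rel P f g)

instance (P : PetriNet.{u}) : Category P.FreeCMC where
  Hom a b := FreeHom P a.marking b.marking
  id a := Quot.mk _ (Raw.idn a.marking)
  comp f g := Quot.map₂ Raw.cmp (fun _ _ _ h => .cmp_congr (.refl _) h)
    (fun _ _ _ h => .cmp_congr h (.refl _)) f g
  id_comp := by rintro _ _ ⟨f⟩; exact Quot.sound (.idn_cmp f)
  comp_id := by rintro _ _ ⟨f⟩; exact Quot.sound (.cmp_idn f)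
  assoc := by rintro _ _ _ _ ⟨f⟩ ⟨g⟩ ⟨h⟩; exact Quot.sound (.cmp_assoc f g h)

/-- The class in `FP` of a formal morphism. -/
def Raw.toHom {P : PetriNet.{u}} {a b : Multiset P.place} (f : Raw P a b) :
    (⟨a⟩ : P.FreeCMC) ⟶ ⟨b⟩ :=
  Quot.mk _ f

theorem Rel.heq {P : PetriNet.{u}} {a b a' b' : Multiset P.place} {f : Raw P a b}
    {g : Raw P a' b'} (h : Rel P f g) : HEq f.toHom g.toHom := by
  obtain ⟨rfl, rfl⟩ := h.ends
  exact heq_of_eq (Quot.sound h)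

/-- The tensor product of `FP`. -/
def freeTensor (P : PetriNet.{u}) : P.FreeCMC × P.FreeCMC ⥤ P.FreeCMC where
  obj x := ⟨x.1.marking + x.2.marking⟩
  map f := Quot.map₂ Raw.add (fun _ _ _ h => .add_congr (.refl _) h)
    (fun _ _ _ h => .add_congr h (.refl _)) f.1 f.2
  map_id _ := Quot.sound (.add_idn _ _)
  map_comp := by
    rintro _ _ _ ⟨⟨f⟩, ⟨f'⟩⟩ ⟨⟨g⟩, ⟨g'⟩⟩
    exact Quot.sound (.add_cmp f g f' g')

instance freeMonObj (P : PetriNet.{u}) : MonObj (Cat.of P.FreeCMC) where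
  one := Cat.Hom.ofFunctor (C := 𝟙_ Cat.{u, u})
    ((Functor.const (𝟙_ Cat.{u, u})).obj (⟨0⟩ : P.FreeCMC))
  mul := Functor.toCatHom P.freeTensor
  one_mul := by
    refine Cat.Hom.ext (Functor.hext (fun x => ?_) ?_)
    · exact congrArg FreeCMC.mk (_root_.zero_add _)
    · rintro ⟨_, a⟩ ⟨_, b⟩ ⟨_, ⟨f⟩⟩
      exact Rel.heq (Rel.zero_add f)
  mul_one := by
    refine Cat.Hom.ext (Functor.hext (fun x => ?_) ?_)
    · exact congrArg FreeCMC.mk (_root_.add_zero _)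
    · rintro ⟨a, _⟩ ⟨b, _⟩ ⟨⟨f⟩, _⟩
      exact Rel.heq ((Rel.add_comm f _).trans (Rel.zero_add f))
  mul_assoc := by
    refine Cat.Hom.ext (Functor.hext (fun x => ?_) ?_)
    · exact congrArg FreeCMC.mk (_root_.add_assoc _ _ _)
    · rintro ⟨⟨_, _⟩, _⟩ ⟨⟨_, _⟩, _⟩ ⟨⟨⟨f⟩, ⟨g⟩⟩, ⟨h⟩⟩
      exact Rel.heq (Rel.add_assoc f g h)

instance freeIsCommMonObj (P : PetriNet.{u}) : IsCommMonObj (Cat.of P.FreeCMC) where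
  mul_comm := by
    refine Cat.Hom.ext (Functor.hext (fun x => ?_) ?_)
    · exact congrArg FreeCMC.mk (_root_.add_comm _ _)
    · rintro ⟨_, _⟩ ⟨_, _⟩ ⟨⟨f⟩, ⟨g⟩⟩
      exact Rel.heq (Rel.add_comm g f)

/-- Transport of a formal morphism along equalities of its ends. -/
def Raw.cast {P : PetriNet.{u}} {a b a' b' : Multiset P.place} (f : Raw P a b) (ha : a = a')
    (hb : b = b') : Raw P a' b' :=
  ha ▸ hb ▸ f

theorem Raw.cast_rel {P : PetriNet.{u}} {a b a' b' : Multiset P.place} (f : Raw P a b)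
    (ha : a = a') (hb : b = b') : Rel P (f.cast ha hb) f := by
  subst ha; subst hb; exact .refl _

/-- The action of a morphism of Petri nets on formal morphisms. -/
def Raw.map {P Q : PetriNet.{u}} (φ : P ⟶ Q) {a b : Multiset P.place} :
    Raw P a b → Raw Q (a.map φ.onPlace) (b.map φ.onPlace)
  | .gen τ => (Raw.gen (φ.onTransition τ)).cast (φ.source_eq τ) (φ.target_eq τ)
  | .idn _ => .idn _
  | .add f g => ((f.map φ).add (g.map φ)).cast
      (Multiset.map_add _ _ _).symm (Multiset.map_add _ _ _).symm
  | .cmp f g => (f.map φ).cmp (g.map φ)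

theorem Raw.map_add_rel {P Q : PetriNet.{u}} (φ : P ⟶ Q) {a b a' b' : Multiset P.place}
    (f : Raw P a b) (g : Raw P a' b') : Rel Q ((f.add g).map φ) ((f.map φ).add (g.map φ)) :=
  Raw.cast_rel _ _ _

theorem Rel.of_idn {P : PetriNet.{u}} {a b : Multiset P.place} (h : a = b) :
    Rel P (Raw.idn a) (Raw.idn b) := by
  subst h; exact .refl _

theorem Rel.map {P Q : PetriNet.{u}} (φ : P ⟶ Q) {a b a' b' : Multiset P.place}
    {f : Raw P a b} {g : Raw P a' b'} (h : Rel P f g) : Rel Q (f.map φ) (g.map φ) := by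
  induction h with
  | refl f => exact .refl _
  | symm _ ih => exact ih.symm
  | trans _ _ ih ih' => exact ih.trans ih'
  | cmp_congr _ _ ih ih' => exact .cmp_congr ih ih'
  | add_congr _ _ ih ih' =>
    exact (Raw.map_add_rel φ _ _).trans ((Rel.add_congr ih ih').trans (Raw.map_add_rel φ _ _).symm)
  | idn_cmp f => exact .idn_cmp _
  | cmp_idn f => exact .cmp_idn _
  | cmp_assoc f g h => exact .cmp_assoc _ _ _
  | add_idn a b =>
    exact (Raw.map_add_rel φ _ _).trans ((Rel.add_idn _ _).trans
      (Rel.of_idn (Multiset.map_add _ _ _).symm))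
  | add_cmp f g f' g' =>
    exact (Raw.map_add_rel φ _ _).trans ((Rel.add_cmp _ _ _ _).trans
      (Rel.cmp_congr (Raw.map_add_rel φ _ _).symm (Raw.map_add_rel φ _ _).symm))
  | add_assoc f g h =>
    exact (Raw.map_add_rel φ _ _).trans ((Rel.add_congr (Raw.map_add_rel φ _ _) (.refl _)).trans
      ((Rel.add_assoc _ _ _).trans ((Rel.add_congr (.refl _) (Raw.map_add_rel φ _ _).symm).trans
        (Raw.map_add_rel φ _ _).symm)))
  | add_comm f g =>
    exact (Raw.map_add_rel φ _ _).trans ((Rel.add_comm _ _).trans (Raw.map_add_rel φ _ _).symm)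
  | zero_add f =>
    exact (Raw.map_add_rel φ _ _).trans (Rel.zero_add _)

theorem Raw.map_id_rel {P : PetriNet.{u}} {a b : Multiset P.place} (f : Raw P a b) :
    Rel P (f.map (𝟙 P)) f := by
  induction f with
  | gen τ => exact Raw.cast_rel _ _ _
  | idn a => exact Rel.of_idn (Multiset.map_id _)
  | add f g ih ih' => exact (Raw.map_add_rel _ _ _).trans (.add_congr ih ih')
  | cmp f g ih ih' => exact .cmp_congr ih ih'

theorem Raw.map_comp_rel {P Q R : PetriNet.{u}} (φ : P ⟶ Q) (ψ : Q ⟶ R)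
    {a b : Multiset P.place} (f : Raw P a b) : Rel R (f.map (φ ≫ ψ)) ((f.map φ).map ψ) := by
  induction f with
  | gen τ =>
    exact (Raw.cast_rel _ _ _).trans (((Raw.cast_rel _ _ _).map ψ).trans (Raw.cast_rel _ _ _)).symm
  | idn a => exact Rel.of_idn (Multiset.map_map ψ.onPlace φ.onPlace _).symm
  | add f g ih ih' =>
    exact (Raw.map_add_rel _ _ _).trans ((Rel.add_congr ih ih').trans
      (((Raw.map_add_rel φ f g).map ψ).trans (Raw.map_add_rel ψ _ _)).symm)
  | cmp f g ih ih' => exact .cmp_congr ih ih'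

/-- The functor `FP ⥤ FQ` induced by a morphism of Petri nets `P ⟶ Q`. -/
def freeMap {P Q : PetriNet.{u}} (φ : P ⟶ Q) : P.FreeCMC ⥤ Q.FreeCMC where
  obj a := ⟨a.marking.map φ.onPlace⟩
  map f := Quot.map (Raw.map φ) (fun _ _ h => h.map φ) f
  map_id _ := rfl
  map_comp := by rintro _ _ _ ⟨f⟩ ⟨g⟩; rfl

instance freeMap_isMonHom {P Q : PetriNet.{u}} (φ : P ⟶ Q) :
    IsMonHom (freeMap φ).toCatHom where
  one_hom := by
    refine Cat.Hom.ext (Functor.hext (fun x => ?_) (fun x y f => ?_))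
    · exact congrArg FreeCMC.mk (Multiset.map_zero φ.onPlace)
    · exact Rel.heq (f := Raw.idn (Multiset.map φ.onPlace 0)) (g := Raw.idn 0)
        (Rel.of_idn (Multiset.map_zero _))
  mul_hom := by
    refine Cat.Hom.ext (Functor.hext (fun x => ?_) ?_)
    · exact congrArg FreeCMC.mk (Multiset.map_add _ _ _)
    · rintro ⟨_, _⟩ ⟨_, _⟩ ⟨⟨f⟩, ⟨g⟩⟩
      exact Rel.heq (Raw.map_add_rel φ f g)

/-- The functor `F : Petri ⥤ CMC`, sending a Petri net to the free commutative monoidal category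
on it. -/
def free : PetriNet.{u} ⥤ CMC.{u} where
  obj P := { X := Cat.of P.FreeCMC }
  map φ := CommMon.homMk { hom := (freeMap φ).toCatHom, isMonHom_hom := freeMap_isMonHom φ }
  map_id P := by
    refine CommMon.hom_ext _ _ (Cat.Hom.ext (Functor.hext (fun x => ?_) ?_))
    · exact congrArg FreeCMC.mk (Multiset.map_id _)
    · rintro _ _ ⟨f⟩
      exact Rel.heq (Raw.map_id_rel f)
  map_comp φ ψ := by
    refine CommMon.hom_ext _ _ (Cat.Hom.ext (Functor.hext (fun x => ?_) ?_))
    · exact congrArg FreeCMC.mk (Multiset.map_map ψ.onPlace φ.onPlace x.marking).symm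
    · rintro _ _ ⟨f⟩
      exact Rel.heq (Raw.map_comp_rel φ ψ f)

/-- The functor `L : Set ⥤ Petri`, sending a set `X` to the Petri net with `X` as its set of places
and no transitions. -/
def discrete : Type u ⥤ PetriNet.{u} where
  obj X := ⟨PEmpty, X, PEmpty.elim, PEmpty.elim⟩
  map f := ⟨_root_.id, f, fun τ => τ.elim, fun τ => τ.elim⟩

end PetriNet

/-- The functor `L' = FL : Set ⥤ CMC`. -/
def freeOnSet : Type u ⥤ CMC.{u} := PetriNet.discrete ⋙ PetriNet.free

/-! ### Symmetric monoidal double categories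

A double category is a category weakly internal to `Cat`.  Its category of arrows `D₁` is presented
here by the fibres of the pair of functors `(S, T) : D₁ ⥤ D₀ × D₀`: horizontal 1-cells are indexed by
their source and target objects, 2-morphisms by the four sides of their frame.  The strict equations
of the definition (`S (U A) = A = T (U A)`, `S (M ⊙ N) = S M`, `T (M ⊙ N) = T N`, the source and the
target of each structure isomorphism, and strict monoidality of `S` and `T`) thus hold by typing.
Horizontal composites are written in diagrammatic order. -/

/-- Horizontal 1-cells and 2-morphisms over a category `C` of objects and vertical 1-morphisms, with
the vertical composition of 2-morphisms.  The three laws are equations between 2-morphisms whose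
frames are equal, but not by definition; so they are equations between triples. -/
structure DoubleCells (C : Type u₀) [Category.{v₀} C] where
  /-- horizontal 1-cells -/
  Hor : C → C → Type u₁
  /-- 2-morphisms with left side `f`, right side `g`, top `M` and bottom `N` -/
  Sq : ∀ {X Y X' Y' : C}, (X ⟶ X') → (Y ⟶ Y') → Hor X Y → Hor X' Y' → Type v₁
  vId : ∀ {X Y : C} (M : Hor X Y), Sq (𝟙 X) (𝟙 Y) M M
  vComp : ∀ {X Y X' Y' X'' Y'' : C} {f : X ⟶ X'} {g : Y ⟶ Y'} {f' : X' ⟶ X''} {g' : Y' ⟶ Y''}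
    {M : Hor X Y} {M' : Hor X' Y'} {M'' : Hor X'' Y''},
    Sq f g M M' → Sq f' g' M' M'' → Sq (f ≫ f') (g ≫ g') M M''
  vId_vComp : ∀ {X Y X' Y' : C} {f : X ⟶ X'} {g : Y ⟶ Y'} {M : Hor X Y} {M' : Hor X' Y'}
    (α : Sq f g M M'),
    (⟨_, _, vComp (vId M) α⟩ : Σ (f : X ⟶ X') (g : Y ⟶ Y'), Sq f g M M') = ⟨_, _, α⟩
  vComp_vId : ∀ {X Y X' Y' : C} {f : X ⟶ X'} {g : Y ⟶ Y'} {M : Hor X Y} {M' : Hor X' Y'}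
    (α : Sq f g M M'),
    (⟨_, _, vComp α (vId M')⟩ : Σ (f : X ⟶ X') (g : Y ⟶ Y'), Sq f g M M') = ⟨_, _, α⟩
  vComp_assoc : ∀ {X₀ Y₀ X₁ Y₁ X₂ Y₂ X₃ Y₃ : C} {f₁ : X₀ ⟶ X₁} {g₁ : Y₀ ⟶ Y₁} {f₂ : X₁ ⟶ X₂}
    {g₂ : Y₁ ⟶ Y₂} {f₃ : X₂ ⟶ X₃} {g₃ : Y₂ ⟶ Y₃} {M₀ : Hor X₀ Y₀} {M₁ : Hor X₁ Y₁}
    {M₂ : Hor X₂ Y₂} {M₃ : Hor X₃ Y₃} (α : Sq f₁ g₁ M₀ M₁) (β : Sq f₂ g₂ M₁ M₂)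
    (γ : Sq f₃ g₃ M₂ M₃),
    (⟨_, _, vComp (vComp α β) γ⟩ : Σ (f : X₀ ⟶ X₃) (g : Y₀ ⟶ Y₃), Sq f g M₀ M₃) =
      ⟨_, _, vComp α (vComp β γ)⟩

namespace DoubleCells

variable {C : Type u₀} [Category.{v₀} C]

/-- The objects of the category of arrows `D₁`: horizontal 1-cells. -/
structure Arr (E : DoubleCells.{u₀, v₀, u₁, v₁} C) where
  src : C
  tgt : C
  hor : E.Hor src tgt

/-- The morphisms of the category of arrows `D₁`: 2-morphisms. -/
structure ArrHom (E : DoubleCells.{u₀, v₀, u₁, v₁} C) (M N : E.Arr) where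
  left : M.src ⟶ N.src
  right : M.tgt ⟶ N.tgt
  sq : E.Sq left right M.hor N.hor

theorem ArrHom.ext_sigma {E : DoubleCells.{u₀, v₀, u₁, v₁} C} {M N : E.Arr}
    {α β : E.ArrHom M N}
    (h : (⟨α.left, α.right, α.sq⟩ : Σ (f : M.src ⟶ N.src) (g : M.tgt ⟶ N.tgt),
      E.Sq f g M.hor N.hor) = ⟨β.left, β.right, β.sq⟩) : α = β := by
  obtain ⟨f, g, s⟩ := α
  obtain ⟨f', g', s'⟩ := β
  cases h
  rfl

/-- The category of arrows `D₁`. -/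
instance (E : DoubleCells.{u₀, v₀, u₁, v₁} C) : Category E.Arr where
  Hom := E.ArrHom
  id M := ⟨𝟙 _, 𝟙 _, E.vId M.hor⟩
  comp α β := ⟨α.left ≫ β.left, α.right ≫ β.right, E.vComp α.sq β.sq⟩
  id_comp α := ArrHom.ext_sigma (E.vId_vComp α.sq)
  comp_id α := ArrHom.ext_sigma (E.vComp_vId α.sq)
  assoc α β γ := ArrHom.ext_sigma (E.vComp_assoc α.sq β.sq γ.sq)

/-- The source functor `S : D₁ ⥤ D₀`. -/
def source (E : DoubleCells.{u₀, v₀, u₁, v₁} C) : E.Arr ⥤ C where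
  obj M := M.src
  map α := α.left

/-- The target functor `T : D₁ ⥤ D₀`. -/
def target (E : DoubleCells.{u₀, v₀, u₁, v₁} C) : E.Arr ⥤ C where
  obj M := M.tgt
  map α := α.right

/-- A 2-morphism, as a morphism of `D₁`. -/
abbrev arr (E : DoubleCells.{u₀, v₀, u₁, v₁} C) {X Y X' Y' : C} {f : X ⟶ X'} {g : Y ⟶ Y'}
    {M : E.Hor X Y} {N : E.Hor X' Y'} (α : E.Sq f g M N) :
    (⟨X, Y, M⟩ : E.Arr) ⟶ (⟨X', Y', N⟩ : E.Arr) :=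
  (⟨f, g, α⟩ : E.ArrHom ⟨X, Y, M⟩ ⟨X', Y', N⟩)

/-- The data of horizontal units `U` and of the horizontal composition `⊙`. -/
structure Horizontal (E : DoubleCells.{u₀, v₀, u₁, v₁} C) where
  unit : ∀ X : C, E.Hor X X
  unitSq : ∀ {X X' : C} (f : X ⟶ X'), E.Sq f f (unit X) (unit X')
  comp : ∀ {X Y Z : C}, E.Hor X Y → E.Hor Y Z → E.Hor X Z
  compSq : ∀ {X Y Z X' Y' Z' : C} {f : X ⟶ X'} {g : Y ⟶ Y'} {h : Z ⟶ Z'} {M : E.Hor X Y}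
    {N : E.Hor Y Z} {M' : E.Hor X' Y'} {N' : E.Hor Y' Z'},
    E.Sq f g M M' → E.Sq g h N N' → E.Sq f h (comp M N) (comp M' N')

/-- The data of a tensor product of horizontal 1-cells and of 2-morphisms, over a tensor product of
objects and of vertical 1-morphisms. -/
structure Tensor [MonoidalCategory C] (E : DoubleCells.{u₀, v₀, u₁, v₁} C) where
  hor : ∀ {X Y X' Y' : C}, E.Hor X Y → E.Hor X' Y' → E.Hor (X ⊗ X') (Y ⊗ Y')
  sq : ∀ {X Y X' Y' Z W Z' W' : C} {f : X ⟶ Z} {g : Y ⟶ W} {f' : X' ⟶ Z'} {g' : Y' ⟶ W'}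
    {M : E.Hor X Y} {M' : E.Hor X' Y'} {N : E.Hor Z W} {N' : E.Hor Z' W'},
    E.Sq f g M N → E.Sq f' g' M' N' → E.Sq (f ⊗ₘ f') (g ⊗ₘ g') (hor M M') (hor N N')

end DoubleCells

/-- A (pseudo) double category with given cells, units and horizontal composition: `U` and `⊙` are
functors, and there are natural globular isomorphisms (associator, unitors) that satisfy the
pentagon and the triangle identities. -/
structure DoubleCategory {C : Type u₀} [Category.{v₀} C] (E : DoubleCells.{u₀, v₀, u₁, v₁} C)
    (H : E.Horizontal) where
  unitSq_id : ∀ X : C, H.unitSq (𝟙 X) = E.vId (H.unit X)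
  unitSq_comp : ∀ {X Y Z : C} (f : X ⟶ Y) (g : Y ⟶ Z),
    H.unitSq (f ≫ g) = E.vComp (H.unitSq f) (H.unitSq g)
  compSq_id : ∀ {X Y Z : C} (M : E.Hor X Y) (N : E.Hor Y Z),
    H.compSq (E.vId M) (E.vId N) = E.vId (H.comp M N)
  compSq_comp : ∀ {X Y Z X' Y' Z' X'' Y'' Z'' : C} {f : X ⟶ X'} {g : Y ⟶ Y'} {h : Z ⟶ Z'}
    {f' : X' ⟶ X''} {g' : Y' ⟶ Y''} {h' : Z' ⟶ Z''} {M : E.Hor X Y} {N : E.Hor Y Z}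
    {M' : E.Hor X' Y'} {N' : E.Hor Y' Z'} {M'' : E.Hor X'' Y''} {N'' : E.Hor Y'' Z''}
    (α : E.Sq f g M M') (β : E.Sq g h N N') (α' : E.Sq f' g' M' M'') (β' : E.Sq g' h' N' N''),
    H.compSq (E.vComp α α') (E.vComp β β') = E.vComp (H.compSq α β) (H.compSq α' β')
  /-- associator of `⊙` -/
  assoc : ∀ {X Y Z W : C} (M : E.Hor X Y) (N : E.Hor Y Z) (P : E.Hor Z W),
    E.Sq (𝟙 X) (𝟙 W) (H.comp (H.comp M N) P) (H.comp M (H.comp N P))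
  assoc_isIso : ∀ {X Y Z W : C} (M : E.Hor X Y) (N : E.Hor Y Z) (P : E.Hor Z W),
    IsIso (E.arr (assoc M N P))
  assoc_natural : ∀ {X Y Z W X' Y' Z' W' : C} {f : X ⟶ X'} {g : Y ⟶ Y'} {h : Z ⟶ Z'} {k : W ⟶ W'}
    {M : E.Hor X Y} {N : E.Hor Y Z} {P : E.Hor Z W} {M' : E.Hor X' Y'} {N' : E.Hor Y' Z'}
    {P' : E.Hor Z' W'} (μ : E.Sq f g M M') (ν : E.Sq g h N N') (π : E.Sq h k P P'),
    E.arr (H.compSq (H.compSq μ ν) π) ≫ E.arr (assoc M' N' P') =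
      E.arr (assoc M N P) ≫ E.arr (H.compSq μ (H.compSq ν π))
  /-- unitor of `⊙` for the unit at the source -/
  leftUnitor : ∀ {X Y : C} (M : E.Hor X Y), E.Sq (𝟙 X) (𝟙 Y) (H.comp (H.unit X) M) M
  leftUnitor_isIso : ∀ {X Y : C} (M : E.Hor X Y), IsIso (E.arr (leftUnitor M))
  leftUnitor_natural : ∀ {X Y X' Y' : C} {f : X ⟶ X'} {g : Y ⟶ Y'} {M : E.Hor X Y}
    {M' : E.Hor X' Y'} (μ : E.Sq f g M M'),
    E.arr (H.compSq (H.unitSq f) μ) ≫ E.arr (leftUnitor M') = E.arr (leftUnitor M) ≫ E.arr μ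
  /-- unitor of `⊙` for the unit at the target -/
  rightUnitor : ∀ {X Y : C} (M : E.Hor X Y), E.Sq (𝟙 X) (𝟙 Y) (H.comp M (H.unit Y)) M
  rightUnitor_isIso : ∀ {X Y : C} (M : E.Hor X Y), IsIso (E.arr (rightUnitor M))
  rightUnitor_natural : ∀ {X Y X' Y' : C} {f : X ⟶ X'} {g : Y ⟶ Y'} {M : E.Hor X Y}
    {M' : E.Hor X' Y'} (μ : E.Sq f g M M'),
    E.arr (H.compSq μ (H.unitSq g)) ≫ E.arr (rightUnitor M') = E.arr (rightUnitor M) ≫ E.arr μ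
  pentagon : ∀ {X Y Z W V : C} (M : E.Hor X Y) (N : E.Hor Y Z) (P : E.Hor Z W) (Q : E.Hor W V),
    E.arr (H.compSq (assoc M N P) (E.vId Q)) ≫ E.arr (assoc M (H.comp N P) Q) ≫
        E.arr (H.compSq (E.vId M) (assoc N P Q)) =
      E.arr (assoc (H.comp M N) P Q) ≫ E.arr (assoc M N (H.comp P Q))
  triangle : ∀ {X Y Z : C} (M : E.Hor X Y) (N : E.Hor Y Z),
    E.arr (assoc M (H.unit Y) N) ≫ E.arr (H.compSq (E.vId M) (leftUnitor N)) =
      E.arr (H.compSq (rightUnitor M) (E.vId N))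

/-- A symmetric monoidal double category with given cells, horizontal composition and tensor
product, over a symmetric monoidal category of objects: the category of arrows is symmetric monoidal
with unit `U_I` (and the source and target functors are strict symmetric monoidal); `⊗` is a double
functor, with comparisons `χ` and `μ`; and its associator, unitors and braiding are transformations
of double functors. -/
structure SymmetricMonoidalDoubleCategory {C : Type u₀} [Category.{v₀} C] [MonoidalCategory C]
    [SymmetricCategory C] (E : DoubleCells.{u₀, v₀, u₁, v₁} C) (H : E.Horizontal) (K : E.Tensor)
    extends DoubleCategory E H where
  tensor_id : ∀ {X Y X' Y' : C} (M : E.Hor X Y) (M' : E.Hor X' Y'),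
    E.arr (K.sq (E.vId M) (E.vId M')) = 𝟙 _
  tensor_comp : ∀ {X Y X' Y' Z W Z' W' U V U' V' : C} {f : X ⟶ Z} {g : Y ⟶ W} {f' : X' ⟶ Z'}
    {g' : Y' ⟶ W'} {h : Z ⟶ U} {k : W ⟶ V} {h' : Z' ⟶ U'} {k' : W' ⟶ V'}
    {M : E.Hor X Y} {M' : E.Hor X' Y'} {N : E.Hor Z W} {N' : E.Hor Z' W'} {P : E.Hor U V}
    {P' : E.Hor U' V'} (α : E.Sq f g M N) (α' : E.Sq f' g' M' N') (β : E.Sq h k N P)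
    (β' : E.Sq h' k' N' P'),
    E.arr (K.sq (E.vComp α β) (E.vComp α' β')) = E.arr (K.sq α α') ≫ E.arr (K.sq β β')
  /-- associator of `⊗` -/
  tAssoc : ∀ {X Y X' Y' X'' Y'' : C} (M : E.Hor X Y) (N : E.Hor X' Y') (P : E.Hor X'' Y''),
    E.Sq (α_ X X' X'').hom (α_ Y Y' Y'').hom (K.hor (K.hor M N) P) (K.hor M (K.hor N P))
  tAssoc_isIso : ∀ {X Y X' Y' X'' Y'' : C} (M : E.Hor X Y) (N : E.Hor X' Y') (P : E.Hor X'' Y''),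
    IsIso (E.arr (tAssoc M N P))
  tAssoc_natural : ∀ {X Y X' Y' X'' Y'' Z W Z' W' Z'' W'' : C} {f : X ⟶ Z} {g : Y ⟶ W}
    {f' : X' ⟶ Z'} {g' : Y' ⟶ W'} {f'' : X'' ⟶ Z''} {g'' : Y'' ⟶ W''} {M : E.Hor X Y}
    {M' : E.Hor X' Y'} {M'' : E.Hor X'' Y''} {N : E.Hor Z W} {N' : E.Hor Z' W'}
    {N'' : E.Hor Z'' W''} (μ : E.Sq f g M N) (μ' : E.Sq f' g' M' N') (μ'' : E.Sq f'' g'' M'' N''),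
    E.arr (K.sq (K.sq μ μ') μ'') ≫ E.arr (tAssoc N N' N'') =
      E.arr (tAssoc M M' M'') ≫ E.arr (K.sq μ (K.sq μ' μ''))
  /-- left unitor of `⊗` -/
  tLeft : ∀ {X Y : C} (M : E.Hor X Y),
    E.Sq (λ_ X).hom (λ_ Y).hom (K.hor (H.unit (𝟙_ C)) M) M
  tLeft_isIso : ∀ {X Y : C} (M : E.Hor X Y), IsIso (E.arr (tLeft M))
  tLeft_natural : ∀ {X Y Z W : C} {f : X ⟶ Z} {g : Y ⟶ W} {M : E.Hor X Y} {N : E.Hor Z W}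
    (μ : E.Sq f g M N),
    E.arr (K.sq (E.vId (H.unit (𝟙_ C))) μ) ≫ E.arr (tLeft N) = E.arr (tLeft M) ≫ E.arr μ
  /-- right unitor of `⊗` -/
  tRight : ∀ {X Y : C} (M : E.Hor X Y),
    E.Sq (ρ_ X).hom (ρ_ Y).hom (K.hor M (H.unit (𝟙_ C))) M
  tRight_isIso : ∀ {X Y : C} (M : E.Hor X Y), IsIso (E.arr (tRight M))
  tRight_natural : ∀ {X Y Z W : C} {f : X ⟶ Z} {g : Y ⟶ W} {M : E.Hor X Y} {N : E.Hor Z W}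
    (μ : E.Sq f g M N),
    E.arr (K.sq μ (E.vId (H.unit (𝟙_ C)))) ≫ E.arr (tRight N) = E.arr (tRight M) ≫ E.arr μ
  tPentagon : ∀ {X Y X' Y' X'' Y'' Z W : C} (M : E.Hor X Y) (N : E.Hor X' Y')
    (P : E.Hor X'' Y'') (Q : E.Hor Z W),
    E.arr (K.sq (tAssoc M N P) (E.vId Q)) ≫ E.arr (tAssoc M (K.hor N P) Q) ≫
        E.arr (K.sq (E.vId M) (tAssoc N P Q)) =
      E.arr (tAssoc (K.hor M N) P Q) ≫ E.arr (tAssoc M N (K.hor P Q))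
  tTriangle : ∀ {X Y X' Y' : C} (M : E.Hor X Y) (N : E.Hor X' Y'),
    E.arr (tAssoc M (H.unit (𝟙_ C)) N) ≫ E.arr (K.sq (E.vId M) (tLeft N)) =
      E.arr (K.sq (tRight M) (E.vId N))
  /-- braiding of `⊗` -/
  braid : ∀ {X Y X' Y' : C} (M : E.Hor X Y) (N : E.Hor X' Y'),
    E.Sq (β_ X X').hom (β_ Y Y').hom (K.hor M N) (K.hor N M)
  braid_natural : ∀ {X Y X' Y' Z W Z' W' : C} {f : X ⟶ Z} {g : Y ⟶ W} {f' : X' ⟶ Z'}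
    {g' : Y' ⟶ W'} {M : E.Hor X Y} {M' : E.Hor X' Y'} {N : E.Hor Z W} {N' : E.Hor Z' W'}
    (μ : E.Sq f g M N) (μ' : E.Sq f' g' M' N'),
    E.arr (K.sq μ μ') ≫ E.arr (braid N N') = E.arr (braid M M') ≫ E.arr (K.sq μ' μ)
  braid_symm : ∀ {X Y X' Y' : C} (M : E.Hor X Y) (N : E.Hor X' Y'),
    E.arr (braid M N) ≫ E.arr (braid N M) = 𝟙 _
  hexagon_forward : ∀ {X Y X' Y' X'' Y'' : C} (M : E.Hor X Y) (N : E.Hor X' Y')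
    (P : E.Hor X'' Y''),
    E.arr (tAssoc M N P) ≫ E.arr (braid M (K.hor N P)) ≫ E.arr (tAssoc N P M) =
      E.arr (K.sq (braid M N) (E.vId P)) ≫ E.arr (tAssoc N M P) ≫
        E.arr (K.sq (E.vId N) (braid M P))
  hexagon_reverse : ∀ {X Y X' Y' X'' Y'' : C} (M : E.Hor X Y) (N : E.Hor X' Y')
    (P : E.Hor X'' Y''),
    E.arr (K.sq (E.vId M) (braid N P)) ≫ inv (E.arr (tAssoc M P N)) ≫
        E.arr (K.sq (braid M P) (E.vId N)) =
      inv (E.arr (tAssoc M N P)) ≫ E.arr (braid (K.hor M N) P) ≫ inv (E.arr (tAssoc P M N))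
  /-- composition comparison of the double functor `⊗` -/
  χ : ∀ {X Y Z X' Y' Z' : C} (M₁ : E.Hor X Y) (N₁ : E.Hor X' Y') (M₂ : E.Hor Y Z)
    (N₂ : E.Hor Y' Z'), E.Sq (𝟙 (X ⊗ X')) (𝟙 (Z ⊗ Z'))
      (H.comp (K.hor M₁ N₁) (K.hor M₂ N₂)) (K.hor (H.comp M₁ M₂) (H.comp N₁ N₂))
  χ_isIso : ∀ {X Y Z X' Y' Z' : C} (M₁ : E.Hor X Y) (N₁ : E.Hor X' Y') (M₂ : E.Hor Y Z)
    (N₂ : E.Hor Y' Z'), IsIso (E.arr (χ M₁ N₁ M₂ N₂))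
  χ_natural : ∀ {X Y Z X' Y' Z' A B D A' B' D' : C} {f : X ⟶ A} {g : Y ⟶ B} {h : Z ⟶ D}
    {f' : X' ⟶ A'} {g' : Y' ⟶ B'} {h' : Z' ⟶ D'} {M₁ : E.Hor X Y} {N₁ : E.Hor X' Y'}
    {M₂ : E.Hor Y Z} {N₂ : E.Hor Y' Z'} {P₁ : E.Hor A B} {Q₁ : E.Hor A' B'} {P₂ : E.Hor B D}
    {Q₂ : E.Hor B' D'} (μ₁ : E.Sq f g M₁ P₁) (ν₁ : E.Sq f' g' N₁ Q₁) (μ₂ : E.Sq g h M₂ P₂)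
    (ν₂ : E.Sq g' h' N₂ Q₂),
    E.arr (H.compSq (K.sq μ₁ ν₁) (K.sq μ₂ ν₂)) ≫ E.arr (χ P₁ Q₁ P₂ Q₂) =
      E.arr (χ M₁ N₁ M₂ N₂) ≫ E.arr (K.sq (H.compSq μ₁ μ₂) (H.compSq ν₁ ν₂))
  /-- identity comparison of the double functor `⊗` -/
  μ : ∀ X Y : C, E.Sq (𝟙 (X ⊗ Y)) (𝟙 (X ⊗ Y)) (H.unit (X ⊗ Y)) (K.hor (H.unit X) (H.unit Y))
  μ_isIso : ∀ X Y : C, IsIso (E.arr (μ X Y))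
  μ_natural : ∀ {X Y X' Y' : C} (f : X ⟶ X') (g : Y ⟶ Y'),
    E.arr (H.unitSq (f ⊗ₘ g)) ≫ E.arr (μ X' Y') =
      E.arr (μ X Y) ≫ E.arr (K.sq (H.unitSq f) (H.unitSq g))
  χ_assoc : ∀ {X Y Z W X' Y' Z' W' : C} (M₁ : E.Hor X Y) (N₁ : E.Hor X' Y') (M₂ : E.Hor Y Z)
    (N₂ : E.Hor Y' Z') (M₃ : E.Hor Z W) (N₃ : E.Hor Z' W'),
    E.arr (H.compSq (χ M₁ N₁ M₂ N₂) (E.vId (K.hor M₃ N₃))) ≫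
        E.arr (χ (H.comp M₁ M₂) (H.comp N₁ N₂) M₃ N₃) ≫
        E.arr (K.sq (assoc M₁ M₂ M₃) (assoc N₁ N₂ N₃)) =
      E.arr (assoc (K.hor M₁ N₁) (K.hor M₂ N₂) (K.hor M₃ N₃)) ≫
        E.arr (H.compSq (E.vId (K.hor M₁ N₁)) (χ M₂ N₂ M₃ N₃)) ≫
        E.arr (χ M₁ N₁ (H.comp M₂ M₃) (H.comp N₂ N₃))
  χ_leftUnitor : ∀ {X Y X' Y' : C} (M : E.Hor X Y) (N : E.Hor X' Y'),
    E.arr (H.compSq (μ X X') (E.vId (K.hor M N))) ≫ E.arr (χ (H.unit X) (H.unit X') M N) ≫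
        E.arr (K.sq (leftUnitor M) (leftUnitor N)) =
      E.arr (leftUnitor (K.hor M N))
  χ_rightUnitor : ∀ {X Y X' Y' : C} (M : E.Hor X Y) (N : E.Hor X' Y'),
    E.arr (H.compSq (E.vId (K.hor M N)) (μ Y Y')) ≫ E.arr (χ M N (H.unit Y) (H.unit Y')) ≫
        E.arr (K.sq (rightUnitor M) (rightUnitor N)) =
      E.arr (rightUnitor (K.hor M N))
  tAssoc_χ : ∀ {X Y Z X' Y' Z' X'' Y'' Z'' : C} (M₁ : E.Hor X Y) (N₁ : E.Hor X' Y')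
    (P₁ : E.Hor X'' Y'') (M₂ : E.Hor Y Z) (N₂ : E.Hor Y' Z') (P₂ : E.Hor Y'' Z''),
    E.arr (χ (K.hor M₁ N₁) P₁ (K.hor M₂ N₂) P₂) ≫
        E.arr (K.sq (χ M₁ N₁ M₂ N₂) (E.vId (H.comp P₁ P₂))) ≫
        E.arr (tAssoc (H.comp M₁ M₂) (H.comp N₁ N₂) (H.comp P₁ P₂)) =
      E.arr (H.compSq (tAssoc M₁ N₁ P₁) (tAssoc M₂ N₂ P₂)) ≫
        E.arr (χ M₁ (K.hor N₁ P₁) M₂ (K.hor N₂ P₂)) ≫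
        E.arr (K.sq (E.vId (H.comp M₁ M₂)) (χ N₁ P₁ N₂ P₂))
  tAssoc_μ : ∀ X Y Z : C,
    E.arr (μ (X ⊗ Y) Z) ≫ E.arr (K.sq (μ X Y) (E.vId (H.unit Z))) ≫
        E.arr (tAssoc (H.unit X) (H.unit Y) (H.unit Z)) =
      E.arr (H.unitSq (α_ X Y Z).hom) ≫ E.arr (μ X (Y ⊗ Z)) ≫
        E.arr (K.sq (E.vId (H.unit X)) (μ Y Z))
  tLeft_χ : ∀ {X Y Z : C} (M : E.Hor X Y) (N : E.Hor Y Z),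
    E.arr (χ (H.unit (𝟙_ C)) M (H.unit (𝟙_ C)) N) ≫
        E.arr (K.sq (leftUnitor (H.unit (𝟙_ C))) (E.vId (H.comp M N))) ≫
        E.arr (tLeft (H.comp M N)) =
      E.arr (H.compSq (tLeft M) (tLeft N))
  tLeft_μ : ∀ X : C,
    E.arr (μ (𝟙_ C) X) ≫ E.arr (tLeft (H.unit X)) = E.arr (H.unitSq (λ_ X).hom)
  tRight_χ : ∀ {X Y Z : C} (M : E.Hor X Y) (N : E.Hor Y Z),
    E.arr (χ M (H.unit (𝟙_ C)) N (H.unit (𝟙_ C))) ≫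
        E.arr (K.sq (E.vId (H.comp M N)) (leftUnitor (H.unit (𝟙_ C)))) ≫
        E.arr (tRight (H.comp M N)) =
      E.arr (H.compSq (tRight M) (tRight N))
  tRight_μ : ∀ X : C,
    E.arr (μ X (𝟙_ C)) ≫ E.arr (tRight (H.unit X)) = E.arr (H.unitSq (ρ_ X).hom)
  braid_χ : ∀ {X Y Z X' Y' Z' : C} (M₁ : E.Hor X Y) (N₁ : E.Hor X' Y') (M₂ : E.Hor Y Z)
    (N₂ : E.Hor Y' Z'),
    E.arr (χ M₁ N₁ M₂ N₂) ≫ E.arr (braid (H.comp M₁ M₂) (H.comp N₁ N₂)) =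
      E.arr (H.compSq (braid M₁ N₁) (braid M₂ N₂)) ≫ E.arr (χ N₁ M₁ N₂ M₂)
  braid_μ : ∀ X Y : C,
    E.arr (μ X Y) ≫ E.arr (braid (H.unit X) (H.unit Y)) =
      E.arr (H.unitSq (β_ X Y).hom) ≫ E.arr (μ Y X)

/-! ### Structured cospans -/

/-- A structured cospan `L a ⟶ x ⟵ L b`. -/
structure StructuredCospan {A : Type u₀} [Category.{v₀} A] {X : Type u₁} [Category.{v₁} X]
    (L : A ⥤ X) (a b : A) where
  apex : X
  inp : L.obj a ⟶ apex
  out : L.obj b ⟶ apex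

namespace StructuredCospan

section

variable {A : Type u₀} [Category.{v₀} A] {X : Type u₁} [Category.{v₁} X] (L : A ⥤ X)

/-- A 2-morphism of structured cospans: a commutative diagram with sides `L f` and `L g`. -/
@[ext]
structure Hom {a b a' b' : A} (f : a ⟶ a') (g : b ⟶ b') (M : StructuredCospan L a b)
    (N : StructuredCospan L a' b') where
  map : M.apex ⟶ N.apex
  inp_comm : M.inp ≫ map = L.map f ≫ N.inp
  out_comm : M.out ≫ map = L.map g ≫ N.out

theorem Hom.sigma_ext {a b a' b' : A} {f f' : a ⟶ a'} {g g' : b ⟶ b'}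
    {M : StructuredCospan L a b} {N : StructuredCospan L a' b'} (α : Hom L f g M N)
    (β : Hom L f' g' M N) (hf : f = f') (hg : g = g') (h : α.map = β.map) :
    (⟨f, g, α⟩ : Σ (f : a ⟶ a') (g : b ⟶ b'), Hom L f g M N) = ⟨f', g', β⟩ := by
  subst hf; subst hg
  rw [Hom.ext h]

/-- Structured cospans as horizontal 1-cells over the category `A`, and their 2-morphisms with
vertical composition. -/
def cells : DoubleCells A where
  Hor := StructuredCospan L
  Sq := Hom L
  vId M := ⟨𝟙 M.apex, by simp, by simp⟩
  vComp α β := ⟨α.map ≫ β.map,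
    by rw [← Category.assoc, α.inp_comm, Category.assoc, β.inp_comm, L.map_comp, Category.assoc],
    by rw [← Category.assoc, α.out_comm, Category.assoc, β.out_comm, L.map_comp, Category.assoc]⟩
  vId_vComp α := Hom.sigma_ext L _ _ (by simp) (by simp) (by simp)
  vComp_vId α := Hom.sigma_ext L _ _ (by simp) (by simp) (by simp)
  vComp_assoc α β γ := Hom.sigma_ext L _ _ (by simp) (by simp) (by simp)

variable [HasFiniteColimits X]

/-- Identity cospans, and composition of structured cospans by pushout. -/
noncomputable def horizontal : (cells L).Horizontal where
  unit a := ⟨L.obj a, 𝟙 _, 𝟙 _⟩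
  unitSq f := ⟨L.map f, by simp, by simp⟩
  comp M N := ⟨pushout M.out N.inp, M.inp ≫ pushout.inl _ _, N.out ≫ pushout.inr _ _⟩
  compSq {_ _ _ _ _ _ _ g _ M N M' N'} α β :=
    ⟨pushout.map M.out N.inp M'.out N'.inp α.map β.map (L.map g) α.out_comm β.inp_comm,
      by rw [Category.assoc, pushout.inl_desc, ← Category.assoc, α.inp_comm, Category.assoc],
      by rw [Category.assoc, pushout.inr_desc, ← Category.assoc, β.out_comm, Category.assoc]⟩

variable [HasFiniteCoproducts A] [L.IsLeftAdjoint]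

attribute [local instance] monoidalOfHasFiniteCoproducts symmetricOfHasFiniteCoproducts

/-- The tensor product of structured cospans: coproducts of feet and of apices, with legs
`L (a + a') ≅ L a + L a' ⟶ x + x'`. -/
noncomputable def tensor : (cells L).Tensor where
  hor {a b a' b'} M M' := ⟨M.apex ⨿ M'.apex,
    inv (coprodComparison L a a') ≫ coprod.map M.inp M'.inp,
    inv (coprodComparison L b b') ≫ coprod.map M.out M'.out⟩
  sq α α' := ⟨coprod.map α.map α'.map,
    by
      simp only [Category.assoc, coprod.map_map, α.inp_comm, α'.inp_comm]
      rw [← coprod.map_map, coprodComparison_inv_natural_assoc]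
      rfl,
    by
      simp only [Category.assoc, coprod.map_map, α.out_comm, α'.out_comm]
      rw [← coprod.map_map, coprodComparison_inv_natural_assoc]
      rfl⟩

/-- A symmetric monoidal double category of `L`-structured cospans: objects and vertical
1-morphisms form `A` with chosen finite coproducts, horizontal 1-cells are structured cospans
composed by pushout, the tensor product is given by coproducts, and all structure isomorphisms are
the canonical ones, i.e. they commute with the coprojections of pushouts and coproducts. -/
structure SymmMonDoubleCat extends
    SymmetricMonoidalDoubleCategory (cells L) (horizontal L) (tensor L) where
  assoc_inl_inl : ∀ {a b c d : A} (M : StructuredCospan L a b) (N : StructuredCospan L b c)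
    (P : StructuredCospan L c d),
    pushout.inl M.out N.inp ≫ pushout.inl (N.out ≫ pushout.inr M.out N.inp) P.inp ≫
      Hom.map (assoc M N P) = pushout.inl M.out (N.inp ≫ pushout.inl N.out P.inp)
  assoc_inr_inl : ∀ {a b c d : A} (M : StructuredCospan L a b) (N : StructuredCospan L b c)
    (P : StructuredCospan L c d),
    pushout.inr M.out N.inp ≫ pushout.inl (N.out ≫ pushout.inr M.out N.inp) P.inp ≫
      Hom.map (assoc M N P) =
        pushout.inl N.out P.inp ≫ pushout.inr M.out (N.inp ≫ pushout.inl N.out P.inp)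
  assoc_inr : ∀ {a b c d : A} (M : StructuredCospan L a b) (N : StructuredCospan L b c)
    (P : StructuredCospan L c d),
    pushout.inr (N.out ≫ pushout.inr M.out N.inp) P.inp ≫ Hom.map (assoc M N P) =
      pushout.inr N.out P.inp ≫ pushout.inr M.out (N.inp ≫ pushout.inl N.out P.inp)
  leftUnitor_inl : ∀ {a b : A} (M : StructuredCospan L a b),
    pushout.inl (𝟙 (L.obj a)) M.inp ≫ Hom.map (leftUnitor M) = M.inp
  leftUnitor_inr : ∀ {a b : A} (M : StructuredCospan L a b),
    pushout.inr (𝟙 (L.obj a)) M.inp ≫ Hom.map (leftUnitor M) = 𝟙 M.apex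
  rightUnitor_inl : ∀ {a b : A} (M : StructuredCospan L a b),
    pushout.inl M.out (𝟙 (L.obj b)) ≫ Hom.map (rightUnitor M) = 𝟙 M.apex
  rightUnitor_inr : ∀ {a b : A} (M : StructuredCospan L a b),
    pushout.inr M.out (𝟙 (L.obj b)) ≫ Hom.map (rightUnitor M) = M.out
  tAssoc_map : ∀ {a b a' b' a'' b'' : A} (M : StructuredCospan L a b)
    (N : StructuredCospan L a' b') (P : StructuredCospan L a'' b''),
    Hom.map (tAssoc M N P) = (coprod.associator M.apex N.apex P.apex).hom
  tLeft_inr : ∀ {a b : A} (M : StructuredCospan L a b),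
    (coprod.inr : M.apex ⟶ L.obj (⊥_ A) ⨿ M.apex) ≫ Hom.map (tLeft M) = 𝟙 M.apex
  tRight_inl : ∀ {a b : A} (M : StructuredCospan L a b),
    (coprod.inl : M.apex ⟶ M.apex ⨿ L.obj (⊥_ A)) ≫ Hom.map (tRight M) = 𝟙 M.apex
  braid_map : ∀ {a b a' b' : A} (M : StructuredCospan L a b) (N : StructuredCospan L a' b'),
    Hom.map (braid M N) = (coprod.braiding M.apex N.apex).hom
  χ_inl : ∀ {a b c a' b' c' : A} (M₁ : StructuredCospan L a b) (N₁ : StructuredCospan L a' b')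
    (M₂ : StructuredCospan L b c) (N₂ : StructuredCospan L b' c'),
    pushout.inl ((tensor L).hor M₁ N₁).out ((tensor L).hor M₂ N₂).inp ≫
        Hom.map (χ M₁ N₁ M₂ N₂) =
      coprod.map (pushout.inl M₁.out M₂.inp) (pushout.inl N₁.out N₂.inp)
  χ_inr : ∀ {a b c a' b' c' : A} (M₁ : StructuredCospan L a b) (N₁ : StructuredCospan L a' b')
    (M₂ : StructuredCospan L b c) (N₂ : StructuredCospan L b' c'),
    pushout.inr ((tensor L).hor M₁ N₁).out ((tensor L).hor M₂ N₂).inp ≫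
        Hom.map (χ M₁ N₁ M₂ N₂) =
      coprod.map (pushout.inr M₁.out M₂.inp) (pushout.inr N₁.out N₂.inp)
  μ_map : ∀ a b : A, Hom.map (μ a b) = inv (coprodComparison L a b)

end

end StructuredCospan

/-! ### Finite colimits of commutative monoid objects -/

section CommMonColimits

/-! The theorem is an instance of a general fact about structured cospans: if `A` has finite
coproducts, `X` has finite colimits and `L : A ⥤ X` is a left adjoint, then cospans `L a ⟶ x ⟵ L b`
form a symmetric monoidal double category. It remains to verify these hypotheses for `freeOnSet`.

Finite colimits of `CMC` come from `CommMon.hasFiniteColimits`, valid for commutative monoid objects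
in any cartesian closed category with coequalizers. The product of two commutative monoids is their
coproduct, by `(a, b) = (a, 1)(1, b)`. A reflexive coequalizer can be computed in the base: since
tensoring preserves coequalizers, the common section lets a multiplication descend one variable at a
time (`exists_tensorHom_desc`). Reflexive coequalizers and binary coproducts give all coequalizers,
and the initial object then gives all finite colimits.

The right adjoint of `freeOnSet` takes the set of objects. A Petri net without transitions generates
a discrete category (`Raw.rel_idn`), so strict monoidal functors out of it are monoid morphisms out
of a free commutative monoid, that is, functions on places (`freeOnSetAdjunction`).

In the double category, an equation of 2-morphisms splits by `arr_ext` into two equations between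
sides in `A` and one between apices in `X`. The sides obey the coherence laws of coproducts in `A`.
On apices, everything is a map out of iterated pushouts and coproducts, determined by its
restrictions to the coprojections. Left adjointness of `L` enters only through preservation of
binary coproducts and of the initial object: this makes the legs of a tensor product well defined,
and makes a pushout of coproducts over `L (b ⨿ b')` a coproduct of pushouts (`pushout.coprodIso`).
-/

theorem CategoryTheory.Limits.hasCoequalizers_of_hasReflexiveCoequalizers (C : Type u)
    [Category.{v} C] [HasBinaryCoproducts C] [HasReflexiveCoequalizers C] : HasCoequalizers C := by
  have {A B : C} (f g : A ⟶ B) : HasCoequalizer f g := by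
    -- Adjoining the identity of `B` to both maps makes the pair reflexive, with section
    -- `coprod.inr`, and does not change which maps out of `B` equalize it.
    have : HasCoequalizer (coprod.desc f (𝟙 B)) (coprod.desc g (𝟙 B)) :=
      hasCoequalizer_of_common_section C coprod.inr (coprod.inr_desc _ _) (coprod.inr_desc _ _)
    have w := coprod.inl ≫= coequalizer.condition (coprod.desc f (𝟙 B)) (coprod.desc g (𝟙 B))
    rw [coprod.inl_desc_assoc, coprod.inl_desc_assoc] at w
    refine ⟨⟨⟨Cofork.ofπ (coequalizer.π (coprod.desc f (𝟙 B)) (coprod.desc g (𝟙 B))) w,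
      Cofork.IsColimit.mk' _ fun s => ?_⟩⟩⟩
    have hs : coprod.desc f (𝟙 B) ≫ s.π = coprod.desc g (𝟙 B) ≫ s.π := by
      apply coprod.hom_ext
      · rw [coprod.inl_desc_assoc, coprod.inl_desc_assoc, s.condition]
      · rw [coprod.inr_desc_assoc, coprod.inr_desc_assoc]
    exact ⟨coequalizer.desc s.π hs, coequalizer.π_desc _ hs, fun {m} hm =>
      coequalizer.hom_ext (hm.trans (coequalizer.π_desc _ hs).symm)⟩
  exact hasCoequalizers_of_hasColimit_parallelPair C

open CategoryTheory.MonObj CartesianMonoidalCategory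

namespace CategoryTheory.MonObj

/-! ### Products of monoid objects as coproducts -/

section Coproduct

variable {C : Type u} [Category.{v} C] [CartesianMonoidalCategory C]

/-- The inclusion of the first factor into a product with a monoid object. -/
abbrev tensorInl (A B : C) [MonObj B] : A ⟶ A ⊗ B := lift (𝟙 A) (toUnit A ≫ η[B])

/-- The inclusion of the second factor into a product with a monoid object. -/
abbrev tensorInr (A B : C) [MonObj A] : B ⟶ A ⊗ B := lift (toUnit B ≫ η[A]) (𝟙 B)

/-- In elements, `f a * g 1 = f a`; only `g` has to preserve the unit. -/
theorem tensorInl_comp_mul {A B D : C} [MonObj B] [MonObj D] (f : A ⟶ D) (g : B ⟶ D)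
    [IsMonHom g] : tensorInl A B ≫ (f ⊗ₘ g) ≫ μ[D] = f := by
  simp [MonObj.lift_comp_one_right]

theorem tensorInr_comp_mul {A B D : C} [MonObj A] [MonObj D] (f : A ⟶ D) (g : B ⟶ D)
    [IsMonHom f] : tensorInr A B ≫ (f ⊗ₘ g) ≫ μ[D] = g := by
  simp [MonObj.lift_comp_one_left]

variable [BraidedCategory C] {A B D : C} [MonObj A] [MonObj B] [MonObj D]

/-- This is `(a, 1) * (1, b) = (a, b)`, computed in the monoid of generalized elements and compared
on the two projections. -/
theorem tensorInl_tensorInr_mul : (tensorInl A B ⊗ₘ tensorInr A B) ≫ μ[A ⊗ B] = 𝟙 (A ⊗ B) := by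
  have h : (tensorInl A B ⊗ₘ tensorInr A B) ≫ μ[A ⊗ B] =
      (fst A B ≫ tensorInl A B) * (snd A B ≫ tensorInr A B) := by
    rw [Hom.mul_def, ← lift_map, Category.assoc]
    simp
  rw [h]
  ext <;> rw [mul_comp] <;> simp [← Hom.one_def]

/-- Uniqueness of the copairing: `k (a, b) = k (a, 1) * k (1, b)`. Commutativity of `D` plays no
role here; it is needed only for the copairing to be a monoid morphism. -/
theorem eq_tensorHom_comp_mul (k : A ⊗ B ⟶ D) [IsMonHom k] :
    k = ((tensorInl A B ≫ k) ⊗ₘ (tensorInr A B ≫ k)) ≫ μ[D] := by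
  rw [← tensorHom_comp_tensorHom, Category.assoc, ← IsMonHom.mul_hom, ← Category.assoc,
    tensorInl_tensorInr_mul, Category.id_comp]

end Coproduct

/-! ### Reflexive coequalizers of monoid objects -/

section Coequalizer

variable {C : Type u} [Category.{v} C] [MonoidalCategory C] [MonoidalClosed C] [HasCoequalizers C]

section

variable {A B : C} (f g : A ⟶ B)

/-- Closedness makes `tensorLeft X` a left adjoint, so it preserves the coequalizer. -/
theorem exists_whiskerLeft_desc {X Z : C} (h : X ⊗ B ⟶ Z) (w : X ◁ f ≫ h = X ◁ g ≫ h) :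
    ∃ k : X ⊗ coequalizer f g ⟶ Z, X ◁ coequalizer.π f g ≫ k = h :=
  ⟨_, (Cofork.IsColimit.desc' (isColimitOfHasCoequalizerOfPreservesColimit (tensorLeft X) f g)
    h w).2⟩

instance epi_whiskerLeft_coequalizer (X : C) : Epi (X ◁ coequalizer.π f g) :=
  inferInstanceAs (Epi ((tensorLeft X).map (coequalizer.π f g)))

variable [BraidedCategory C]

instance epi_coequalizer_whiskerRight (X : C) : Epi (coequalizer.π f g ▷ X) :=
  inferInstanceAs (Epi ((tensorRight X).map (coequalizer.π f g)))

instance epi_coequalizer_tensorHom : Epi (coequalizer.π f g ⊗ₘ coequalizer.π f g) := by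
  rw [MonoidalCategory.tensorHom_def]
  infer_instance

theorem exists_whiskerRight_desc {X Z : C} (h : B ⊗ X ⟶ Z) (w : f ▷ X ≫ h = g ▷ X ≫ h) :
    ∃ k : coequalizer f g ⊗ X ⟶ Z, coequalizer.π f g ▷ X ≫ k = h :=
  ⟨_, (Cofork.IsColimit.desc' (isColimitOfHasCoequalizerOfPreservesColimit (tensorRight X) f g)
    h w).2⟩

/-- The tensor square of a reflexive coequalizer is a weak coequalizer. -/
theorem exists_tensorHom_desc [IsReflexivePair f g] {Z : C} (h : B ⊗ B ⟶ Z)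
    (w : (f ⊗ₘ f) ≫ h = (g ⊗ₘ g) ≫ h) :
    ∃ k : coequalizer f g ⊗ coequalizer f g ⟶ Z,
      (coequalizer.π f g ⊗ₘ coequalizer.π f g) ≫ k = h := by
  obtain ⟨s, hf, hg⟩ := IsReflexivePair.common_section f g
  have w₁ : f ▷ B ≫ h = g ▷ B ≫ h := by
    -- Inserting the common section in the second variable turns `f ⊗ₘ f` into `f ▷ B` and `g ⊗ₘ g`
    -- into `g ▷ B`, because `s` is a section of both. This is where reflexivity is used.
    have := A ◁ s ≫= w
    rwa [← MonoidalCategory.id_tensorHom, tensorHom_comp_tensorHom_assoc,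
      tensorHom_comp_tensorHom_assoc, hf, hg, Category.id_comp, Category.id_comp,
      MonoidalCategory.tensorHom_id, MonoidalCategory.tensorHom_id] at this
  have w₂ : B ◁ f ≫ h = B ◁ g ≫ h := by
    have := s ▷ A ≫= w
    rwa [← MonoidalCategory.tensorHom_id, tensorHom_comp_tensorHom_assoc,
      tensorHom_comp_tensorHom_assoc, hf, hg, Category.id_comp, Category.id_comp,
      MonoidalCategory.id_tensorHom, MonoidalCategory.id_tensorHom] at this
  obtain ⟨k, hk⟩ := exists_whiskerRight_desc f g h w₁
  -- Having descended in the first variable, descend in the second. The required equation has the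
  -- coequalizer in its first variable, and is checked after the epimorphism `coequalizer.π f g ▷
  -- A`.
  obtain ⟨l, hl⟩ := exists_whiskerLeft_desc f g k (by
    rw [← cancel_epi (coequalizer.π f g ▷ A), ← whisker_exchange_assoc, ← whisker_exchange_assoc,
      hk, w₂])
  exact ⟨l, by rw [MonoidalCategory.tensorHom_def, Category.assoc, hl, hk]⟩

end

variable [BraidedCategory C] {A B : C} (f g : A ⟶ B) [IsReflexivePair f g] [MonObj A]
  [MonObj B] [IsMonHom f] [IsMonHom g]

/-- As `f` and `g` are multiplicative, `μ[B]` followed by the projection reduces to the coequalizer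
condition after multiplying in `A`. -/
theorem exists_coequalizer_mul : ∃ k, (coequalizer.π f g ⊗ₘ coequalizer.π f g) ≫ k =
    μ[B] ≫ coequalizer.π f g := by
  apply exists_tensorHom_desc
  rw [← IsMonHom.mul_hom_assoc, ← IsMonHom.mul_hom_assoc, coequalizer.condition]

/-- The multiplication of a reflexive coequalizer of monoid objects. -/
noncomputable def coequalizerMul : coequalizer f g ⊗ coequalizer f g ⟶ coequalizer f g :=
  (exists_coequalizer_mul f g).choose

theorem π_coequalizerMul : (coequalizer.π f g ⊗ₘ coequalizer.π f g) ≫ coequalizerMul f g =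
    μ[B] ≫ coequalizer.π f g :=
  (exists_coequalizer_mul f g).choose_spec

/-- Each law holds after precomposition with a tensor power of the projection, where it becomes the
law of `B`; these tensor powers are epimorphisms since tensoring preserves coequalizers. -/
noncomputable instance coequalizerMonObj : MonObj (coequalizer f g) where
  one := η[B] ≫ coequalizer.π f g
  mul := coequalizerMul f g
  one_mul := by
    rw [← cancel_epi (𝟙_ C ◁ coequalizer.π f g), MonoidalCategory.comp_whiskerRight,
      Category.assoc, whisker_exchange_assoc, ← tensorHom_def'_assoc, π_coequalizerMul]
    simp
  mul_one := by
    rw [← cancel_epi (coequalizer.π f g ▷ 𝟙_ C), MonoidalCategory.whiskerLeft_comp,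
      Category.assoc, ← whisker_exchange_assoc, ← tensorHom_def_assoc, π_coequalizerMul]
    simp
  mul_assoc := by
    have : Epi ((coequalizer.π f g ⊗ₘ coequalizer.π f g) ⊗ₘ coequalizer.π f g) := by
      have : Epi ((coequalizer.π f g ⊗ₘ coequalizer.π f g) ▷ B) :=
        inferInstanceAs (Epi ((tensorRight B).map (coequalizer.π f g ⊗ₘ coequalizer.π f g)))
      rw [MonoidalCategory.tensorHom_def]
      infer_instance
    have hl : ((coequalizer.π f g ⊗ₘ coequalizer.π f g) ⊗ₘ coequalizer.π f g) ≫
        coequalizerMul f g ▷ coequalizer f g =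
          μ[B] ▷ B ≫ (coequalizer.π f g ⊗ₘ coequalizer.π f g) := by
      rw [← MonoidalCategory.tensorHom_id, ← MonoidalCategory.tensorHom_id,
        tensorHom_comp_tensorHom, tensorHom_comp_tensorHom, π_coequalizerMul, Category.comp_id,
        Category.id_comp]
    have hr : (coequalizer.π f g ⊗ₘ coequalizer.π f g ⊗ₘ coequalizer.π f g) ≫
        coequalizer f g ◁ coequalizerMul f g =
          B ◁ μ[B] ≫ (coequalizer.π f g ⊗ₘ coequalizer.π f g) := by
      rw [← MonoidalCategory.id_tensorHom, ← MonoidalCategory.id_tensorHom,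
        tensorHom_comp_tensorHom, tensorHom_comp_tensorHom, π_coequalizerMul, Category.comp_id,
        Category.id_comp]
    rw [← cancel_epi ((coequalizer.π f g ⊗ₘ coequalizer.π f g) ⊗ₘ coequalizer.π f g),
      MonoidalCategory.associator_naturality_assoc, reassoc_of% hl, reassoc_of% hr,
      π_coequalizerMul]
    simp

instance coequalizerπ_isMonHom : IsMonHom (coequalizer.π f g) where
  one_hom := rfl
  mul_hom := (π_coequalizerMul f g).symm

instance [IsCommMonObj B] : IsCommMonObj (coequalizer f g) where
  mul_comm := by
    rw [← cancel_epi (coequalizer.π f g ⊗ₘ coequalizer.π f g)]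
    erw [BraidedCategory.braiding_naturality_assoc]
    rw [← IsMonHom.mul_hom, IsCommMonObj.mul_comm_assoc]

theorem isMonHom_of_coequalizerπ_comp {D : C} [MonObj D] (k : coequalizer f g ⟶ D)
    [IsMonHom (coequalizer.π f g ≫ k)] : IsMonHom k where
  one_hom := by
    have := IsMonHom.one_hom (coequalizer.π f g ≫ k)
    rwa [← Category.assoc, IsMonHom.one_hom] at this
  mul_hom := by
    rw [← cancel_epi (coequalizer.π f g ⊗ₘ coequalizer.π f g), ← IsMonHom.mul_hom_assoc,
      IsMonHom.mul_hom, tensorHom_comp_tensorHom_assoc]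

end Coequalizer

end CategoryTheory.MonObj

namespace CategoryTheory.CommMon

/-! ### Coproducts and coequalizers in `CommMon C` -/

variable {C : Type u} [Category.{v} C]

section

variable [MonoidalCategory C] [BraidedCategory C]

/-- A monoid morphism as a morphism of commutative monoid objects. -/
abbrev ofHom {A B : C} [MonObj A] [IsCommMonObj A] [MonObj B] [IsCommMonObj B] (f : A ⟶ B)
    [IsMonHom f] : CommMon.mk A ⟶ CommMon.mk B :=
  homMk (Mon.ofHom f)

/-- The morphism of underlying objects of a morphism of commutative monoid objects. -/
abbrev under {A B : CommMon C} (f : A ⟶ B) : A.X ⟶ B.X := f.hom.hom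

instance {A B : CommMon C} (f : A ⟶ B) : IsMonHom (under f) := f.hom.isMonHom_hom

end

/-- The copairing is `(a, b) ↦ f a * g b`; it is a monoid morphism because multiplication of a
commutative monoid is one. -/
instance [CartesianMonoidalCategory C] [BraidedCategory C] : HasBinaryCoproducts (CommMon C) :=
  have (A B : CommMon C) : HasColimit (pair A B) :=
    ⟨⟨⟨BinaryCofan.mk (P := .mk (A.X ⊗ B.X)) (ofHom (tensorInl A.X B.X))
        (ofHom (tensorInr A.X B.X)),
      BinaryCofan.IsColimit.mk _ (fun {D} f g => ofHom ((under f ⊗ₘ under g) ≫ μ[D.X]))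
      (fun f g => hom_ext _ _ (tensorInl_comp_mul (under f) (under g)))
      (fun f g => hom_ext _ _ (tensorInr_comp_mul (under f) (under g)))
      fun f g m hl hr => hom_ext _ _ (by
        subst hl hr
        let m' : CommMon.mk (A.X ⊗ B.X) ⟶ _ := m
        exact eq_tensorHom_comp_mul (under m'))⟩⟩⟩
  hasBinaryCoproducts_of_hasColimit_pair _

section

variable [MonoidalCategory C] [BraidedCategory C] [MonoidalClosed C] [HasCoequalizers C]

/-- The underlying pair in `C` is still reflexive, so its coequalizer carries a commutative monoid
structure, and the induced maps out of it are again monoid morphisms. -/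
theorem hasCoequalizer_of_isReflexivePair {A B : CommMon C} (f g : A ⟶ B)
    [IsReflexivePair f g] : HasCoequalizer f g := by
  obtain ⟨s, hf, hg⟩ := IsReflexivePair.common_section f g
  have : IsReflexivePair (under f) (under g) :=
    .mk' (under s) (congrArg under hf) (congrArg under hg)
  exact ⟨⟨⟨Cofork.ofπ (P := .mk (coequalizer (under f) (under g)))
    (ofHom (coequalizer.π (under f) (under g)))
    (hom_ext _ _ (coequalizer.condition (under f) (under g))),
    Cofork.IsColimit.mk' _ fun s =>
      have w : under f ≫ under s.π = under g ≫ under s.π := congrArg under s.condition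
      have h : coequalizer.π (under f) (under g) ≫ coequalizer.desc (under s.π) w = under s.π :=
        coequalizer.π_desc _ _
      have : IsMonHom (coequalizer.π (under f) (under g) ≫ coequalizer.desc (under s.π) w) := by
        rw [h]; infer_instance
      have := isMonHom_of_coequalizerπ_comp (under f) (under g) (coequalizer.desc (under s.π) w)
      ⟨ofHom (coequalizer.desc (under s.π) w), hom_ext _ _ h, fun {m} hm => hom_ext _ _
        (coequalizer.hom_ext ((congrArg under hm).trans h.symm))⟩⟩⟩⟩

end

/-- Commutative monoid objects in a cartesian closed category with coequalizers have finite
colimits. -/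
theorem hasFiniteColimits [CartesianMonoidalCategory C] [BraidedCategory C] [MonoidalClosed C]
    [HasCoequalizers C] : HasFiniteColimits (CommMon C) := by
  have : HasReflexiveCoequalizers (CommMon C) :=
    ⟨fun _ _ f g _ => hasCoequalizer_of_isReflexivePair f g⟩
  have := hasCoequalizers_of_hasReflexiveCoequalizers (CommMon C)
  have := hasFiniteCoproducts_of_has_binary_and_initial (C := CommMon C)
  exact hasFiniteColimits_of_hasCoequalizers_and_finite_coproducts

end CategoryTheory.CommMon

end CommMonColimits

/-- The hypotheses hold because `Cat` is cartesian closed and has coequalizers. -/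
theorem CMC.hasFiniteColimits : HasFiniteColimits CMC.{u} := CommMon.hasFiniteColimits

/-! ### The free commutative monoidal category on a set -/

theorem CategoryTheory.Functor.ext_of_isDiscrete {C : Type u} [Category.{v} C] [IsDiscrete C]
    {D : Type w} [Category.{v₀} D] {F G : C ⥤ D} (h : ∀ x, F.obj x = G.obj x) : F = G := by
  refine Functor.hext h fun x y f => ?_
  obtain rfl := IsDiscrete.eq_of_hom f
  obtain rfl : f = 𝟙 x := Subsingleton.elim _ _
  rw [F.map_id, G.map_id, h]

/-! ### The monoid of objects -/

namespace CMC

open CategoryTheory.MonObj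

/-- The objects of a commutative monoidal category form a commutative monoid. -/
instance objCommMonoid (A : CMC.{u}) : CommMonoid A.X where
  one := η[A.X].toFunctor.obj ⟨⟨⟨⟩⟩⟩
  mul x y := μ[A.X].toFunctor.obj (x, y)
  one_mul x := congrArg (fun F : 𝟙_ Cat.{u, u} ⊗ A.X ⟶ A.X => F.toFunctor.obj (⟨⟨⟨⟩⟩⟩, x))
    (MonObj.one_mul A.X)
  mul_one x := congrArg (fun F : A.X ⊗ 𝟙_ Cat.{u, u} ⟶ A.X => F.toFunctor.obj (x, ⟨⟨⟨⟩⟩⟩))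
    (MonObj.mul_one A.X)
  mul_assoc x y z := congrArg (fun F : (A.X ⊗ A.X) ⊗ A.X ⟶ A.X => F.toFunctor.obj ((x, y), z))
    (MonObj.mul_assoc A.X)
  -- The pair is reversed because the braiding swaps it before multiplying.
  mul_comm x y := congrArg (fun F : A.X ⊗ A.X ⟶ A.X => F.toFunctor.obj (y, x))
    (IsCommMonObj.mul_comm A.X)

/-- The action on objects of a strict monoidal functor, as a morphism of monoids. -/
def objHom {A B : CMC.{u}} (F : A ⟶ B) : A.X →* B.X where
  toFun x := F.hom.hom.toFunctor.obj x
  map_one' := congrArg (fun F : 𝟙_ Cat.{u, u} ⟶ B.X => F.toFunctor.obj ⟨⟨⟨⟩⟩⟩)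
    (IsMonHom.one_hom F.hom.hom)
  map_mul' x y := congrArg (fun F : A.X ⊗ A.X ⟶ B.X => F.toFunctor.obj (x, y))
    (IsMonHom.mul_hom F.hom.hom)

/-- The functor sending a commutative monoidal category to its set of objects. -/
def objects : CMC.{u} ⥤ Type u where
  obj A := A.X
  map F := ↾(objHom F)

end CMC

/-! ### Petri nets without transitions -/

namespace PetriNet

variable {P : PetriNet.{u}}

/-- Without generators, formal morphisms are built from identities by sums and composites, and the
laws collapse each of these to an identity. -/
theorem Raw.rel_idn [IsEmpty P.transition] {a b : Multiset P.place} (f : Raw P a b) :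
    a = b ∧ Rel P f (Raw.idn a) := by
  induction f with
  | gen τ => exact isEmptyElim τ
  | idn a => exact ⟨rfl, .refl _⟩
  | add f g ih ih' =>
    obtain ⟨rfl, h⟩ := ih
    obtain ⟨rfl, h'⟩ := ih'
    exact ⟨rfl, (Rel.add_congr h h').trans (.add_idn _ _)⟩
  | cmp f g ih ih' =>
    obtain ⟨rfl, h⟩ := ih
    obtain ⟨rfl, h'⟩ := ih'
    exact ⟨rfl, (Rel.cmp_congr h h').trans (.idn_cmp _)⟩

instance [IsEmpty P.transition] : IsDiscrete P.FreeCMC where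
  subsingleton a b := ⟨by
    rintro ⟨f⟩ ⟨g⟩
    exact Quot.sound ((Raw.rel_idn f).2.trans (Raw.rel_idn g).2.symm)⟩
  eq_of_hom := by
    rintro ⟨a⟩ ⟨b⟩ ⟨f⟩
    exact congrArg FreeCMC.mk (Raw.rel_idn f).1

/-- A function on places, extended to a strict monoidal functor on a free commutative monoidal
category without generating morphisms. -/
def freeLiftHom [IsEmpty P.transition] {A : CMC.{u}} (φ : P.place → A.X) :
    Cat.of P.FreeCMC ⟶ A.X :=
  Functor.toCatHom
    { obj a := (a.marking.map φ).prod
      -- The source is discrete, so a morphism forces its ends to be equal and can only go to the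
      -- corresponding identity.
      map f := eqToHom (congrArg (fun a : P.FreeCMC => (a.marking.map φ).prod)
        (IsDiscrete.eq_of_hom f)) }

/-- The functors compared start from the terminal category or from the square of a discrete one, so
only their values on objects matter, and there a multiset product respects zero and sums. -/
instance freeLiftHom_isMonHom [IsEmpty P.transition] {A : CMC.{u}} (φ : P.place → A.X) :
    IsMonHom (freeLiftHom φ) where
  one_hom := by
    refine Cat.Hom.ext (Cat.fromChosenTerminalEquiv.injective ?_)
    exact (congrArg Multiset.prod (Multiset.map_zero φ)).trans Multiset.prod_zero
  mul_hom := by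
    have : IsDiscrete (Cat.of P.FreeCMC ⊗ Cat.of P.FreeCMC : Cat) :=
      inferInstanceAs (IsDiscrete (P.FreeCMC × P.FreeCMC))
    refine Cat.Hom.ext (Functor.ext_of_isDiscrete fun x => ?_)
    exact (congrArg Multiset.prod (Multiset.map_add φ _ _)).trans (Multiset.prod_add _ _)

/-- The universal property of a free commutative monoidal category without generating
morphisms. -/
def freeLift [IsEmpty P.transition] {A : CMC.{u}} (φ : P.place → A.X) : free.obj P ⟶ A :=
  CommMon.homMk { hom := freeLiftHom φ, isMonHom_hom := freeLiftHom_isMonHom φ }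

/-- Discreteness leaves only the monoid morphism on objects, and multisets are generated by
singletons. -/
theorem free_hom_ext [IsEmpty P.transition] {A : CMC.{u}} {F G : free.obj P ⟶ A}
    (h : ∀ x : P.place, CMC.objHom F (⟨{x}⟩ : P.FreeCMC) = CMC.objHom G (⟨{x}⟩ : P.FreeCMC)) :
    F = G := by
  have : IsDiscrete (free.obj P).toMon.X := inferInstanceAs (IsDiscrete P.FreeCMC)
  refine CommMon.hom_ext _ _ (Cat.Hom.ext (Functor.ext_of_isDiscrete ?_))
  rintro ⟨a⟩
  change CMC.objHom F (⟨a⟩ : P.FreeCMC) = CMC.objHom G (⟨a⟩ : P.FreeCMC)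
  induction a using Multiset.induction_on with
  | empty => exact (CMC.objHom F).map_one.trans (CMC.objHom G).map_one.symm
  | cons x a ih =>
    -- The marking `x ::ₘ a` is definitionally `{x} + a`, the tensor product of two smaller
    -- markings.
    exact ((CMC.objHom F).map_mul (⟨{x}⟩ : P.FreeCMC) (⟨a⟩ : P.FreeCMC)).trans
      ((congrArg₂ _ (h x) ih).trans
        ((CMC.objHom G).map_mul (⟨{x}⟩ : P.FreeCMC) (⟨a⟩ : P.FreeCMC)).symm)

theorem objHom_freeLift [IsEmpty P.transition] {A : CMC.{u}} (φ : P.place → A.X) (x : P.place) :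
    CMC.objHom (freeLift φ) (⟨{x}⟩ : P.FreeCMC) = φ x :=
  (congrArg Multiset.prod (Multiset.map_singleton φ x)).trans (Multiset.prod_singleton _)

instance (X : Type u) : IsEmpty (discrete.obj X).transition := inferInstanceAs (IsEmpty PEmpty)

end PetriNet

/-- The functor `L'` is left adjoint to the functor of objects. -/
def freeOnSetAdjunction : freeOnSet.{u} ⊣ CMC.objects.{u} :=
  Adjunction.mkOfHomEquiv
    { homEquiv X A :=
        { toFun F := ↾fun x => CMC.objHom F (⟨{x}⟩ : (PetriNet.discrete.obj X).FreeCMC)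
          invFun φ := PetriNet.freeLift (P := PetriNet.discrete.obj X) φ
          left_inv F := PetriNet.free_hom_ext fun x => PetriNet.objHom_freeLift _ x
          right_inv φ := by
            ext x
            exact PetriNet.objHom_freeLift (P := PetriNet.discrete.obj X) φ x }
      -- On the singleton of `x` both sides give `g (f x)`; the second side gets there because `{x}`
      -- is first mapped to `{f x}`.
      homEquiv_naturality_left_symm f g := PetriNet.free_hom_ext fun x => by
        refine (PetriNet.objHom_freeLift _ x).trans (Eq.symm ?_)
        refine Eq.trans ?_ (PetriNet.objHom_freeLift (P := PetriNet.discrete.obj _) g (f x))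
        exact congrArg (fun m => CMC.objHom (PetriNet.freeLift _)
          (⟨m⟩ : (PetriNet.discrete.obj _).FreeCMC)) (Multiset.map_singleton f x)
      homEquiv_naturality_right f g := rfl }

instance freeOnSet_isLeftAdjoint : freeOnSet.{u}.IsLeftAdjoint :=
  freeOnSetAdjunction.isLeftAdjoint

/-! ### Coherence of pushouts -/

namespace CategoryTheory.Limits.pushout

variable {C : Type u} [Category.{v} C] [HasPushouts C]

attribute [local simp] inl_desc inl_desc_assoc inr_desc inr_desc_assoc

section

variable {S S' M M' N N' Z : C} {p : S ⟶ M} {q : S ⟶ N} {p' : S' ⟶ M'} {q' : S' ⟶ N'}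
  {m : M ⟶ M'} {n : N ⟶ N'} {s : S ⟶ S'} (h₁ : p ≫ m = s ≫ p') (h₂ : q ≫ n = s ≫ q')

theorem inl_map : pushout.inl p q ≫ pushout.map p q p' q' m n s h₁ h₂ = m ≫ pushout.inl p' q' :=
  inl_desc _ _ _

theorem inl_map_assoc (k : pushout p' q' ⟶ Z) :
    pushout.inl p q ≫ pushout.map p q p' q' m n s h₁ h₂ ≫ k = m ≫ pushout.inl p' q' ≫ k := by
  rw [← Category.assoc, inl_map, Category.assoc]

theorem inr_map : pushout.inr p q ≫ pushout.map p q p' q' m n s h₁ h₂ = n ≫ pushout.inr p' q' :=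
  inr_desc _ _ _

theorem inr_map_assoc (k : pushout p' q' ⟶ Z) :
    pushout.inr p q ≫ pushout.map p q p' q' m n s h₁ h₂ ≫ k = n ≫ pushout.inr p' q' ≫ k := by
  rw [← Category.assoc, inr_map, Category.assoc]

end

attribute [local simp] inl_map inl_map_assoc inr_map inr_map_assoc

/-- The coprojections of the three objects into the iterated pushout are jointly epimorphic, and
every map involved has a known value on them. The pentagon below has the same reason, with four
objects. -/
theorem map_comp_assoc_hom {S T M N P S' T' M' N' P' : C} {p : S ⟶ M} {q : S ⟶ N} {r : T ⟶ N}
    {s : T ⟶ P} {p' : S' ⟶ M'} {q' : S' ⟶ N'} {r' : T' ⟶ N'} {s' : T' ⟶ P'} {b : S ⟶ S'}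
    {c : T ⟶ T'} {m : M ⟶ M'} {n : N ⟶ N'} {k : P ⟶ P'} (hp : p ≫ m = b ≫ p')
    (hq : q ≫ n = b ≫ q') (hr : r ≫ n = c ≫ r') (hs : s ≫ k = c ≫ s') :
    pushout.map (r ≫ pushout.inr p q) s (r' ≫ pushout.inr p' q') s'
        (pushout.map p q p' q' m n b hp hq) k c (by simp [reassoc_of% hr]) hs ≫
      (pushoutAssoc p' q' r' s').hom =
    (pushoutAssoc p q r s).hom ≫ pushout.map p (q ≫ pushout.inl r s) p' (q' ≫ pushout.inl r' s')
      m (pushout.map r s r' s' n k c hr hs) b hp (by simp [reassoc_of% hq]) := by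
  ext <;> simp

theorem pentagon {S T U M N P Q : C} (p : S ⟶ M) (q : S ⟶ N) (r : T ⟶ N) (s : T ⟶ P)
    (t : U ⟶ P) (z : U ⟶ Q) :
    pushout.map (t ≫ pushout.inr (r ≫ pushout.inr p q) s) z
        ((t ≫ pushout.inr r s) ≫ pushout.inr p (q ≫ pushout.inl r s)) z
        (pushoutAssoc p q r s).hom (𝟙 Q) (𝟙 U) (by simp) (by simp) ≫
      (pushoutAssoc p (q ≫ pushout.inl r s) (t ≫ pushout.inr r s) z).hom ≫
      pushout.map p ((q ≫ pushout.inl r s) ≫ pushout.inl (t ≫ pushout.inr r s) z) p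
        (q ≫ pushout.inl r (s ≫ pushout.inl t z)) (𝟙 M) (pushoutAssoc r s t z).hom (𝟙 S)
        (by simp) (by simp) =
    (pushoutAssoc (r ≫ pushout.inr p q) s t z).hom ≫
      (pushoutAssoc p q r (s ≫ pushout.inl t z)).hom := by
  ext <;> simp

theorem map_comp_desc_id {S S' M M' : C} {p : S ⟶ M} {p' : S' ⟶ M'} {s : S ⟶ S'} {m : M ⟶ M'}
    (h : p ≫ m = s ≫ p') :
    pushout.map (𝟙 S) p (𝟙 S') p' s m s (by simp) h ≫ pushout.desc p' (𝟙 M') (by simp) =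
      pushout.desc p (𝟙 M) (by simp) ≫ m := by
  apply pushout.hom_ext <;> simp [h]

theorem map_id_comp_desc {S S' M M' : C} {p : S ⟶ M} {p' : S' ⟶ M'} {s : S ⟶ S'} {m : M ⟶ M'}
    (h : p ≫ m = s ≫ p') :
    pushout.map p (𝟙 S) p' (𝟙 S') m s s h (by simp) ≫ pushout.desc (𝟙 M') p' (by simp) =
      pushout.desc (𝟙 M) p (by simp) ≫ m := by
  apply pushout.hom_ext <;> simp [h]

theorem triangle {S M N : C} (p : S ⟶ M) (q : S ⟶ N) :
    (pushoutAssoc p (𝟙 S) (𝟙 S) q).hom ≫ pushout.map p (𝟙 S ≫ pushout.inl (𝟙 S) q) p q (𝟙 M)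
        (pushout.desc q (𝟙 N) (by simp)) (𝟙 S) (by simp) (by simp) =
      pushout.map (𝟙 S ≫ pushout.inr p (𝟙 S)) q p q (pushout.desc (𝟙 M) p (by simp)) (𝟙 N) (𝟙 S)
        (by simp) (by simp) := by
  -- On the middle copy of `S` one side is `q` followed by `inr`, the other `p` followed by `inl`;
  -- the pushout condition identifies them.
  ext <;> simp [pushout.condition]

/-- The pushout of an identity is an isomorphism, and this map is its inverse. -/
instance isIso_desc_id_right {S M : C} (p : S ⟶ M) :
    IsIso (pushout.desc (f := 𝟙 S) (g := p) p (𝟙 M) (by simp)) := by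
  have h : pushout.inr (𝟙 S) p ≫ pushout.desc (f := 𝟙 S) (g := p) p (𝟙 M) (by simp) = 𝟙 _ :=
    inr_desc _ _ _
  exact IsIso.of_isIso_fac_left h

instance isIso_desc_id_left {S M : C} (p : S ⟶ M) :
    IsIso (pushout.desc (f := p) (g := 𝟙 S) (𝟙 M) p (by simp)) := by
  have h : pushout.inl p (𝟙 S) ≫ pushout.desc (f := p) (g := 𝟙 S) (𝟙 M) p (by simp) = 𝟙 _ :=
    inl_desc _ _ _
  exact IsIso.of_isIso_fac_left h

end CategoryTheory.Limits.pushout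

/-! ### The double category of structured cospans -/

namespace StructuredCospan

variable {A : Type u₀} [Category.{v₀} A] {X : Type u₁} [Category.{v₁} X] {L : A ⥤ X}

/-- The functor sending a structured cospan to its apex. -/
def apexFunctor (L : A ⥤ X) : (cells L).Arr ⥤ X where
  obj M := M.hor.apex
  map α := α.sq.map

/-- The source, target and apex functors are jointly faithful. This splits each axiom of the double
category into two laws in `A` and one in `X`, and absorbs the fact that the frames agree only
propositionally. -/
theorem arr_ext {M N : (cells L).Arr} {α β : M ⟶ N}
    (hs : (cells L).source.map α = (cells L).source.map β)
    (ht : (cells L).target.map α = (cells L).target.map β)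
    (ha : (apexFunctor L).map α = (apexFunctor L).map β) : α = β :=
  DoubleCells.ArrHom.ext_sigma (Hom.sigma_ext L _ _ hs ht ha)

/-- Inverting the apex map and both sides preserves the commutation with the legs. -/
theorem isIso_arr {a b a' b' : A} {f : a ⟶ a'} {g : b ⟶ b'} {M : StructuredCospan L a b}
    {N : StructuredCospan L a' b'} (α : Hom L f g M N) [IsIso f] [IsIso g] (h : IsIso α.map) :
    IsIso ((cells L).arr (M := M) (N := N) α) := by
  refine ⟨(cells L).arr (M := N) (N := M) (f := inv f) (g := inv g) ⟨inv α.map, ?_, ?_⟩, ?_, ?_⟩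
  · rw [IsIso.comp_inv_eq, Category.assoc, α.inp_comm, Functor.map_inv, IsIso.inv_hom_id_assoc]
  · rw [IsIso.comp_inv_eq, Category.assoc, α.out_comm, Functor.map_inv, IsIso.inv_hom_id_assoc]
  · exact arr_ext (IsIso.hom_inv_id f) (IsIso.hom_inv_id g) (IsIso.hom_inv_id α.map)
  · exact arr_ext (IsIso.inv_hom_id f) (IsIso.inv_hom_id g) (IsIso.inv_hom_id α.map)

section Horizontal

variable [HasFiniteColimits X]

/-- The associator of the composition of structured cospans. -/
noncomputable def assoc {a b c d : A} (M : StructuredCospan L a b) (N : StructuredCospan L b c)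
    (P : StructuredCospan L c d) : Hom L (𝟙 a) (𝟙 d)
      ((horizontal L).comp ((horizontal L).comp M N) P)
      ((horizontal L).comp M ((horizontal L).comp N P)) where
  map := (pushoutAssoc M.out N.inp N.out P.inp).hom
  inp_comm := by simp [horizontal]
  out_comm := by simp [horizontal]

/-- The left unitor of the composition of structured cospans. -/
noncomputable def leftUnitor {a b : A} (M : StructuredCospan L a b) : Hom L (𝟙 a) (𝟙 b)
    ((horizontal L).comp ((horizontal L).unit a) M) M where
  map := pushout.desc (f := 𝟙 (L.obj a)) M.inp (𝟙 M.apex) (by simp)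
  inp_comm := by simp [horizontal, pushout.inl_desc]
  out_comm := by simp [horizontal, pushout.inr_desc]

/-- The right unitor of the composition of structured cospans. -/
noncomputable def rightUnitor {a b : A} (M : StructuredCospan L a b) : Hom L (𝟙 a) (𝟙 b)
    ((horizontal L).comp M ((horizontal L).unit b)) M where
  map := pushout.desc (g := 𝟙 (L.obj b)) (𝟙 M.apex) M.out (by simp)
  inp_comm := by simp [horizontal, pushout.inl_desc]
  out_comm := by simp [horizontal, pushout.inr_desc]

/-- What naturality of a globular isomorphism says about the sides of the frame. -/
theorem comp_id_eq_id_comp {C : Type u} [Category.{v} C] {a b : C} (f : a ⟶ b) :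
    f ≫ 𝟙 b = 𝟙 a ≫ f := by simp

variable (L) in
/-- The double category of structured cospans. -/
noncomputable def doubleCategory : DoubleCategory (cells L) (horizontal L) where
  unitSq_id a := Hom.ext (L.map_id a)
  unitSq_comp f g := Hom.ext (L.map_comp f g)
  compSq_id M N := Hom.ext (pushout.map_id (f := M.out) (g := N.inp))
  compSq_comp α β α' β' := Hom.ext (pushout.map_comp _ _ _ _ _ _ α.out_comm β.inp_comm
    α'.out_comm β'.inp_comm).symm
  assoc := assoc
  assoc_isIso M N P := isIso_arr (assoc M N P)
    (inferInstanceAs (IsIso (pushoutAssoc M.out N.inp N.out P.inp).hom))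
  assoc_natural μ ν π := arr_ext (comp_id_eq_id_comp _) (comp_id_eq_id_comp _)
    (pushout.map_comp_assoc_hom μ.out_comm ν.inp_comm ν.out_comm π.inp_comm)
  leftUnitor := leftUnitor
  leftUnitor_isIso M := isIso_arr (leftUnitor M) (pushout.isIso_desc_id_right _)
  leftUnitor_natural μ := arr_ext (comp_id_eq_id_comp _) (comp_id_eq_id_comp _)
    (pushout.map_comp_desc_id μ.inp_comm)
  rightUnitor := rightUnitor
  rightUnitor_isIso M := isIso_arr (rightUnitor M) (pushout.isIso_desc_id_left _)
  rightUnitor_natural μ := arr_ext (comp_id_eq_id_comp _) (comp_id_eq_id_comp _)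
    (pushout.map_id_comp_desc μ.out_comm)
  pentagon M N P Q := arr_ext (congrArg (𝟙 _ ≫ ·) (Category.comp_id _))
    (congrArg (𝟙 _ ≫ ·) (Category.comp_id _))
    (pushout.pentagon M.out N.inp N.out P.inp P.out Q.inp)
  triangle M N := arr_ext (Category.comp_id _) (Category.comp_id _)
    (pushout.triangle M.out N.inp)

end Horizontal

end StructuredCospan

/-! ### Pushouts of coproducts -/

namespace CategoryTheory.Limits.pushout

variable {C : Type u} [Category.{v} C] [HasPushouts C] [HasBinaryCoproducts C]

attribute [local simp] inl_desc inl_desc_assoc inr_desc inr_desc_assoc inl_map inl_map_assoc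
  inr_map inr_map_assoc

section

variable {S M N S' M' N' T : C} (p : S ⟶ M) (q : S ⟶ N) (p' : S' ⟶ M') (q' : S' ⟶ N')
  (e : T ⟶ S ⨿ S') [IsIso e]

/-- The isomorphism `e` stands for `inv (coprodComparison L b b')`. Being invertible it can be
cancelled, so the pushout over `T` is also one over `S ⨿ S'`; keeping it abstract lets the coherence
of pushouts and coproducts be proved without mentioning `L`. -/
theorem coprod_map_comp_inl : coprod.map p p' ≫ pushout.inl (e ≫ coprod.map p p')
    (e ≫ coprod.map q q') = coprod.map q q' ≫ pushout.inr _ _ := by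
  rw [← cancel_epi e, ← Category.assoc, pushout.condition, Category.assoc]

/-- A pushout of coproducts is a coproduct of pushouts. -/
noncomputable def coprodIso : pushout (e ≫ coprod.map p p') (e ≫ coprod.map q q') ≅
    pushout p q ⨿ pushout p' q' where
  hom := pushout.desc (coprod.map (pushout.inl p q) (pushout.inl p' q'))
    (coprod.map (pushout.inr p q) (pushout.inr p' q')) (by simp [pushout.condition])
  inv := coprod.desc
    (pushout.desc (coprod.inl ≫ pushout.inl _ _) (coprod.inl ≫ pushout.inr _ _)
      (by simpa using coprod.inl ≫= coprod_map_comp_inl p q p' q' e))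
    (pushout.desc (coprod.inr ≫ pushout.inl _ _) (coprod.inr ≫ pushout.inr _ _)
      (by simpa using coprod.inr ≫= coprod_map_comp_inl p q p' q' e))
  hom_inv_id := by ext <;> simp [-coprod.desc_comp, coprod.inl_desc, coprod.inr_desc]
  inv_hom_id := by ext <;> simp [-coprod.desc_comp, coprod.inl_desc_assoc, coprod.inr_desc_assoc]

theorem inl_coprodIso_hom : pushout.inl _ _ ≫ (coprodIso p q p' q' e).hom =
    coprod.map (pushout.inl p q) (pushout.inl p' q') :=
  inl_desc _ _ _

theorem inr_coprodIso_hom : pushout.inr _ _ ≫ (coprodIso p q p' q' e).hom =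
    coprod.map (pushout.inr p q) (pushout.inr p' q') :=
  inr_desc _ _ _

theorem inl_coprodIso_hom_assoc {Z : C} (h : pushout p q ⨿ pushout p' q' ⟶ Z) :
    pushout.inl _ _ ≫ (coprodIso p q p' q' e).hom ≫ h =
      coprod.map (pushout.inl p q) (pushout.inl p' q') ≫ h :=
  inl_desc_assoc _ _ _ _

theorem inr_coprodIso_hom_assoc {Z : C} (h : pushout p q ⨿ pushout p' q' ⟶ Z) :
    pushout.inr _ _ ≫ (coprodIso p q p' q' e).hom ≫ h =
      coprod.map (pushout.inr p q) (pushout.inr p' q') ≫ h :=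
  inr_desc_assoc _ _ _ _

end

attribute [local simp] inl_coprodIso_hom inr_coprodIso_hom inl_coprodIso_hom_assoc
  inr_coprodIso_hom_assoc

/-- Here and in the interchange laws below, both sides start from pushouts of coproducts and are
compared on coprojections. The map `t` between the feet enters only through `h` and `h'`, which in
the application are leg conditions of 2-morphisms. -/
theorem map_comp_coprodIso_hom {S M N S' M' N' T S₁ M₁ N₁ S₁' M₁' N₁' T₁ : C} {p : S ⟶ M}
    {q : S ⟶ N} {p' : S' ⟶ M'} {q' : S' ⟶ N'} {e : T ⟶ S ⨿ S'} [IsIso e] {p₁ : S₁ ⟶ M₁}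
    {q₁ : S₁ ⟶ N₁} {p₁' : S₁' ⟶ M₁'} {q₁' : S₁' ⟶ N₁'} {e₁ : T₁ ⟶ S₁ ⨿ S₁'} [IsIso e₁]
    {s : S ⟶ S₁} {s' : S' ⟶ S₁'} {t : T ⟶ T₁} {m : M ⟶ M₁} {n : N ⟶ N₁} {m' : M' ⟶ M₁'}
    {n' : N' ⟶ N₁'} (hp : p ≫ m = s ≫ p₁) (hq : q ≫ n = s ≫ q₁) (hp' : p' ≫ m' = s' ≫ p₁')
    (hq' : q' ≫ n' = s' ≫ q₁')
    (h : (e ≫ coprod.map p p') ≫ coprod.map m m' = t ≫ e₁ ≫ coprod.map p₁ p₁')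
    (h' : (e ≫ coprod.map q q') ≫ coprod.map n n' = t ≫ e₁ ≫ coprod.map q₁ q₁') :
    pushout.map (e ≫ coprod.map p p') (e ≫ coprod.map q q') (e₁ ≫ coprod.map p₁ p₁')
        (e₁ ≫ coprod.map q₁ q₁') (coprod.map m m') (coprod.map n n') t h h' ≫
      (coprodIso p₁ q₁ p₁' q₁' e₁).hom =
    (coprodIso p q p' q' e).hom ≫
      coprod.map (pushout.map p q p₁ q₁ m n s hp hq)
        (pushout.map p' q' p₁' q₁' m' n' s' hp' hq') := by
  ext <;> simp

theorem coprodIso_assoc {S T M N P S' T' M' N' P' V W : C} (p : S ⟶ M) (q : S ⟶ N) (r : T ⟶ N)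
    (s : T ⟶ P) (p' : S' ⟶ M') (q' : S' ⟶ N') (r' : T' ⟶ N') (s' : T' ⟶ P') (e : V ⟶ S ⨿ S')
    [IsIso e] (d : W ⟶ T ⨿ T') [IsIso d] :
    pushout.map ((d ≫ coprod.map r r') ≫ pushout.inr (e ≫ coprod.map p p') (e ≫ coprod.map q q'))
        (d ≫ coprod.map s s')
        (d ≫ coprod.map (r ≫ pushout.inr p q) (r' ≫ pushout.inr p' q')) (d ≫ coprod.map s s')
        (coprodIso p q p' q' e).hom (𝟙 (P ⨿ P')) (𝟙 W) (by simp) (by simp) ≫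
      (coprodIso (r ≫ pushout.inr p q) s (r' ≫ pushout.inr p' q') s' d).hom ≫
      coprod.map (pushoutAssoc p q r s).hom (pushoutAssoc p' q' r' s').hom =
    (pushoutAssoc (e ≫ coprod.map p p') (e ≫ coprod.map q q') (d ≫ coprod.map r r')
        (d ≫ coprod.map s s')).hom ≫
      pushout.map (e ≫ coprod.map p p')
        ((e ≫ coprod.map q q') ≫ pushout.inl (d ≫ coprod.map r r') (d ≫ coprod.map s s'))
        (e ≫ coprod.map p p')
        (e ≫ coprod.map (q ≫ pushout.inl r s) (q' ≫ pushout.inl r' s'))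
        (𝟙 (M ⨿ M')) (coprodIso r s r' s' d).hom (𝟙 V) (by simp) (by simp) ≫
      (coprodIso p (q ≫ pushout.inl r s) p' (q' ≫ pushout.inl r' s') e).hom := by
  ext <;> simp

theorem coprodIso_leftUnitor {S M S' M' T : C} (p : S ⟶ M) (p' : S' ⟶ M') (e : T ⟶ S ⨿ S')
    [IsIso e] :
    pushout.map (𝟙 T) (e ≫ coprod.map p p') (e ≫ coprod.map (𝟙 S) (𝟙 S')) (e ≫ coprod.map p p')
        e (𝟙 (M ⨿ M')) (𝟙 T) (by simp) (by simp) ≫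
      (coprodIso (𝟙 S) p (𝟙 S') p' e).hom ≫
      coprod.map (pushout.desc p (𝟙 M) (by simp)) (pushout.desc p' (𝟙 M') (by simp)) =
    pushout.desc (e ≫ coprod.map p p') (𝟙 (M ⨿ M')) (by simp) := by
  apply pushout.hom_ext <;> simp

theorem coprodIso_rightUnitor {S M S' M' T : C} (p : S ⟶ M) (p' : S' ⟶ M') (e : T ⟶ S ⨿ S')
    [IsIso e] :
    pushout.map (e ≫ coprod.map p p') (𝟙 T) (e ≫ coprod.map p p') (e ≫ coprod.map (𝟙 S) (𝟙 S'))
        (𝟙 (M ⨿ M')) e (𝟙 T) (by simp) (by simp) ≫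
      (coprodIso p (𝟙 S) p' (𝟙 S') e).hom ≫
      coprod.map (pushout.desc (𝟙 M) p (by simp)) (pushout.desc (𝟙 M') p' (by simp)) =
    pushout.desc (𝟙 (M ⨿ M')) (e ≫ coprod.map p p') (by simp) := by
  apply pushout.hom_ext <;> simp

/-- The apex part of the compatibility of the interchange with the associator of the tensor product;
four comparison isomorphisms occur, one for each bracketed tensor of feet. -/
theorem coprodIso_associator {S M N S' M' N' S'' M'' N'' T T₁ U U₁ : C} (p : S ⟶ M) (q : S ⟶ N)
    (p' : S' ⟶ M') (q' : S' ⟶ N') (p'' : S'' ⟶ M'') (q'' : S'' ⟶ N'') (e : T ⟶ S ⨿ S') [IsIso e]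
    (e₁ : T₁ ⟶ T ⨿ S'') [IsIso e₁] (d : U ⟶ S' ⨿ S'') [IsIso d] (d₁ : U₁ ⟶ S ⨿ U) [IsIso d₁]
    (t : T₁ ⟶ U₁)
    (h : (e₁ ≫ coprod.map (e ≫ coprod.map p p') p'') ≫ (coprod.associator M M' M'').hom =
      t ≫ d₁ ≫ coprod.map p (d ≫ coprod.map p' p''))
    (h' : (e₁ ≫ coprod.map (e ≫ coprod.map q q') q'') ≫ (coprod.associator N N' N'').hom =
      t ≫ d₁ ≫ coprod.map q (d ≫ coprod.map q' q'')) :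
    (coprodIso (e ≫ coprod.map p p') (e ≫ coprod.map q q') p'' q'' e₁).hom ≫
      coprod.map (coprodIso p q p' q' e).hom (𝟙 (pushout p'' q'')) ≫
      (coprod.associator (pushout p q) (pushout p' q') (pushout p'' q'')).hom =
    pushout.map (e₁ ≫ coprod.map (e ≫ coprod.map p p') p'')
        (e₁ ≫ coprod.map (e ≫ coprod.map q q') q'') (d₁ ≫ coprod.map p (d ≫ coprod.map p' p''))
        (d₁ ≫ coprod.map q (d ≫ coprod.map q' q'')) (coprod.associator M M' M'').hom
        (coprod.associator N N' N'').hom t h h' ≫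
      (coprodIso p q (d ≫ coprod.map p' p'') (d ≫ coprod.map q' q'') d₁).hom ≫
      coprod.map (𝟙 (pushout p q)) (coprodIso p' q' p'' q'' d).hom := by
  ext <;> simp

theorem coprodIso_leftUnit {I S M N T : C} (hI : IsInitial I) (p : S ⟶ M) (q : S ⟶ N)
    (e : T ⟶ I ⨿ S) [IsIso e] (t : T ⟶ S)
    (h : (e ≫ coprod.map (𝟙 I) p) ≫ coprod.desc (hI.to M) (𝟙 M) = t ≫ p)
    (h' : (e ≫ coprod.map (𝟙 I) q) ≫ coprod.desc (hI.to N) (𝟙 N) = t ≫ q) :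
    (coprodIso (𝟙 I) (𝟙 I) p q e).hom ≫
      coprod.map (pushout.desc (𝟙 I) (𝟙 I) rfl) (𝟙 (pushout p q)) ≫
      coprod.desc (hI.to _) (𝟙 (pushout p q)) =
    pushout.map (e ≫ coprod.map (𝟙 I) p) (e ≫ coprod.map (𝟙 I) q) p q
      (coprod.desc (hI.to M) (𝟙 M)) (coprod.desc (hI.to N) (𝟙 N)) t h h' := by
  -- Components out of `I` agree by initiality; the others are computed.
  ext <;> first | apply hI.hom_ext | simp

theorem coprodIso_rightUnit {I S M N T : C} (hI : IsInitial I) (p : S ⟶ M) (q : S ⟶ N)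
    (e : T ⟶ S ⨿ I) [IsIso e] (t : T ⟶ S)
    (h : (e ≫ coprod.map p (𝟙 I)) ≫ coprod.desc (𝟙 M) (hI.to M) = t ≫ p)
    (h' : (e ≫ coprod.map q (𝟙 I)) ≫ coprod.desc (𝟙 N) (hI.to N) = t ≫ q) :
    (coprodIso p q (𝟙 I) (𝟙 I) e).hom ≫
      coprod.map (𝟙 (pushout p q)) (pushout.desc (𝟙 I) (𝟙 I) rfl) ≫
      coprod.desc (𝟙 (pushout p q)) (hI.to _) =
    pushout.map (e ≫ coprod.map p (𝟙 I)) (e ≫ coprod.map q (𝟙 I)) p q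
      (coprod.desc (𝟙 M) (hI.to M)) (coprod.desc (𝟙 N) (hI.to N)) t h h' := by
  ext <;> first | apply hI.hom_ext | simp

theorem coprodIso_braiding {S M N S' M' N' T U : C} (p : S ⟶ M) (q : S ⟶ N) (p' : S' ⟶ M')
    (q' : S' ⟶ N') (e : T ⟶ S ⨿ S') [IsIso e] (d : U ⟶ S' ⨿ S) [IsIso d] (t : T ⟶ U)
    (h : (e ≫ coprod.map p p') ≫ (coprod.braiding M M').hom = t ≫ d ≫ coprod.map p' p)
    (h' : (e ≫ coprod.map q q') ≫ (coprod.braiding N N').hom = t ≫ d ≫ coprod.map q' q) :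
    (coprodIso p q p' q' e).hom ≫ (coprod.braiding (pushout p q) (pushout p' q')).hom =
      pushout.map (e ≫ coprod.map p p') (e ≫ coprod.map q q') (d ≫ coprod.map p' p)
          (d ≫ coprod.map q' q) (coprod.braiding M M').hom (coprod.braiding N N').hom t h h' ≫
        (coprodIso p' q' p q d).hom := by
  ext <;> simp

end CategoryTheory.Limits.pushout

/-! ### Functors preserving binary coproducts -/

namespace CategoryTheory.Limits

variable {A : Type u₀} [Category.{v₀} A] {X : Type u₁} [Category.{v₁} X] {L : A ⥤ X}
  [HasBinaryCoproducts A] [HasBinaryCoproducts X] [∀ a b, IsIso (coprodComparison L a b)]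

/-- As the comparison is invertible, `L.obj (a ⨿ b)` is a coproduct with coprojections the images
under `L`. -/
theorem map_coprod_hom_ext {a b : A} {z : X} {f g : L.obj (a ⨿ b) ⟶ z}
    (hl : L.map coprod.inl ≫ f = L.map coprod.inl ≫ g)
    (hr : L.map coprod.inr ≫ f = L.map coprod.inr ≫ g) : f = g := by
  rw [← cancel_epi (coprodComparison L a b)]
  ext <;> simpa

attribute [local simp] coprod.inl_desc coprod.inr_desc coprod.inl_desc_assoc
  coprod.inr_desc_assoc map_inl_inv_coprodComparison map_inr_inv_coprodComparison
  map_inl_inv_coprodComparison_assoc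
  map_inr_inv_coprodComparison_assoc

theorem inv_coprodComparison_associator {a b c : A} {M N P : X} (i : L.obj a ⟶ M) (j : L.obj b ⟶ N)
    (k : L.obj c ⟶ P) :
    (inv (coprodComparison L (a ⨿ b) c) ≫
        coprod.map (inv (coprodComparison L a b) ≫ coprod.map i j) k) ≫
      (coprod.associator M N P).hom =
    L.map (coprod.associator a b c).hom ≫ inv (coprodComparison L a (b ⨿ c)) ≫
      coprod.map i (inv (coprodComparison L b c) ≫ coprod.map j k) := by
  -- The values of the image of the associator on the three summands, computed in `A` before
  -- applying `L`.
  have h₁ : L.map coprod.inl ≫ L.map coprod.inl ≫ L.map (coprod.associator a b c).hom =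
      L.map coprod.inl := by
    simp only [← L.map_comp]
    congr 1
    simp
  have h₂ : L.map coprod.inr ≫ L.map coprod.inl ≫ L.map (coprod.associator a b c).hom =
      L.map coprod.inl ≫ L.map coprod.inr := by
    simp only [← L.map_comp]
    congr 1
    simp
  have h₃ : L.map coprod.inr ≫ L.map (coprod.associator a b c).hom =
      L.map coprod.inr ≫ L.map coprod.inr := by
    simp only [← L.map_comp]
    congr 1
    simp
  apply map_coprod_hom_ext
  · apply map_coprod_hom_ext
    · rw [reassoc_of% h₁]
      simp
    · rw [reassoc_of% h₂]
      simp
  · rw [reassoc_of% h₃]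
    simp

theorem inv_coprodComparison_braiding {a b : A} {M N : X} (i : L.obj a ⟶ M) (j : L.obj b ⟶ N) :
    (inv (coprodComparison L a b) ≫ coprod.map i j) ≫ (coprod.braiding M N).hom =
      L.map (coprod.braiding a b).hom ≫ inv (coprodComparison L b a) ≫ coprod.map j i := by
  have h₁ : (coprod.inl : a ⟶ a ⨿ b) ≫ (coprod.braiding a b).hom = coprod.inr := by simp
  have h₂ : (coprod.inr : b ⟶ a ⨿ b) ≫ (coprod.braiding a b).hom = coprod.inl := by simp
  apply map_coprod_hom_ext
  · rw [← L.map_comp_assoc, h₁]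
    simp
  · rw [← L.map_comp_assoc, h₂]
    simp

theorem inv_coprodComparison_leftUnitor {a b : A} {M : X} (ha : IsInitial a)
    (hL : IsInitial (L.obj a)) (i : L.obj b ⟶ M) :
    (inv (coprodComparison L a b) ≫ coprod.map (𝟙 (L.obj a)) i) ≫ coprod.desc (hL.to M) (𝟙 M) =
      L.map (coprod.desc (ha.to b) (𝟙 b)) ≫ i := by
  apply map_coprod_hom_ext
  · apply hL.hom_ext
  · rw [← L.map_comp_assoc, coprod.inr_desc]
    simp

theorem inv_coprodComparison_rightUnitor {a b : A} {M : X} (ha : IsInitial a)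
    (hL : IsInitial (L.obj a)) (i : L.obj b ⟶ M) :
    (inv (coprodComparison L b a) ≫ coprod.map i (𝟙 (L.obj a))) ≫ coprod.desc (𝟙 M) (hL.to M) =
      L.map (coprod.desc (𝟙 b) (ha.to b)) ≫ i := by
  apply map_coprod_hom_ext
  · rw [← L.map_comp_assoc, coprod.inl_desc]
    simp
  · apply hL.hom_ext

/-- The preceding leg conditions for identity legs are exactly the coherence laws of the unit
comparison `μ`. -/
theorem inv_coprodComparison_associator_id (a b c : A) :
    inv (coprodComparison L (a ⨿ b) c) ≫
        coprod.map (inv (coprodComparison L a b)) (𝟙 (L.obj c)) ≫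
        (coprod.associator (L.obj a) (L.obj b) (L.obj c)).hom =
      L.map (coprod.associator a b c).hom ≫ inv (coprodComparison L a (b ⨿ c)) ≫
        coprod.map (𝟙 (L.obj a)) (inv (coprodComparison L b c)) := by
  simpa using inv_coprodComparison_associator (𝟙 (L.obj a)) (𝟙 (L.obj b)) (𝟙 (L.obj c))

theorem inv_coprodComparison_braiding_id (a b : A) :
    inv (coprodComparison L a b) ≫ (coprod.braiding (L.obj a) (L.obj b)).hom =
      L.map (coprod.braiding a b).hom ≫ inv (coprodComparison L b a) := by
  simpa using inv_coprodComparison_braiding (𝟙 (L.obj a)) (𝟙 (L.obj b))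

theorem inv_coprodComparison_leftUnitor_id {a b : A} (ha : IsInitial a)
    (hL : IsInitial (L.obj a)) :
    inv (coprodComparison L a b) ≫ coprod.desc (hL.to (L.obj b)) (𝟙 (L.obj b)) =
      L.map (coprod.desc (ha.to b) (𝟙 b)) := by
  simpa using inv_coprodComparison_leftUnitor ha hL (𝟙 (L.obj b))

theorem inv_coprodComparison_rightUnitor_id {a b : A} (ha : IsInitial a)
    (hL : IsInitial (L.obj a)) :
    inv (coprodComparison L b a) ≫ coprod.desc (𝟙 (L.obj b)) (hL.to (L.obj b)) =
      L.map (coprod.desc (𝟙 b) (ha.to b)) := by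
  simpa using inv_coprodComparison_rightUnitor ha hL (𝟙 (L.obj b))

end CategoryTheory.Limits

/-! ### Coproducts with an initial object -/

namespace CategoryTheory.Limits.IsInitial

variable {C : Type u} [Category.{v} C] [HasBinaryCoproducts C] {I : C} (hI : IsInitial I)

attribute [local simp] coprod.inl_desc coprod.inr_desc coprod.inl_desc_assoc coprod.inr_desc_assoc

theorem isIso_coprod_desc_left (M : C) : IsIso (coprod.desc (hI.to M) (𝟙 M)) :=
  ⟨coprod.inr, by ext; apply hI.hom_ext; simp, by simp⟩

theorem isIso_coprod_desc_right (M : C) : IsIso (coprod.desc (𝟙 M) (hI.to M)) :=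
  ⟨coprod.inl, by ext; simp; apply hI.hom_ext, by simp⟩

theorem coprod_map_comp_desc_left {M N : C} (f : M ⟶ N) :
    coprod.map (𝟙 I) f ≫ coprod.desc (hI.to N) (𝟙 N) = coprod.desc (hI.to M) (𝟙 M) ≫ f := by
  ext <;> first | apply hI.hom_ext | simp

theorem coprod_map_comp_desc_right {M N : C} (f : M ⟶ N) :
    coprod.map f (𝟙 I) ≫ coprod.desc (𝟙 N) (hI.to N) = coprod.desc (𝟙 M) (hI.to M) ≫ f := by
  ext <;> first | apply hI.hom_ext | simp

theorem coprod_triangle (M N : C) :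
    (coprod.associator M I N).hom ≫ coprod.map (𝟙 M) (coprod.desc (hI.to N) (𝟙 N)) =
      coprod.map (coprod.desc (𝟙 M) (hI.to M)) (𝟙 N) := by
  ext <;> first | apply hI.hom_ext | simp

end CategoryTheory.Limits.IsInitial

/-! ### Coherence of symmetric monoidal categories -/

namespace CategoryTheory.MonoidalCategory

variable {C : Type u} [Category.{v} C] [MonoidalCategory C]

/-- The tensor of 2-morphisms is given by `⊗ₘ` with identities, not by whiskering, so the monoidal
laws are needed in this form. They serve for the sides in `A` and, for the hexagons, also for the
apices in `X` with its coproduct structure. -/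
theorem hexagon_reverse_tensorHom [BraidedCategory C] (a b c : C) :
    (𝟙 a ⊗ₘ (β_ b c).hom) ≫ inv (α_ a c b).hom ≫ ((β_ a c).hom ⊗ₘ 𝟙 b) =
      inv (α_ a b c).hom ≫ (β_ (a ⊗ b) c).hom ≫ inv (α_ c a b).hom := by
  simp

theorem hexagon_forward_tensorHom [BraidedCategory C] (a b c : C) :
    (α_ a b c).hom ≫ (β_ a (b ⊗ c)).hom ≫ (α_ b c a).hom =
      ((β_ a b).hom ⊗ₘ 𝟙 c) ≫ (α_ b a c).hom ≫ (𝟙 b ⊗ₘ (β_ a c).hom) := by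
  simp

theorem pentagon_tensorHom (a b c d : C) :
    ((α_ a b c).hom ⊗ₘ 𝟙 d) ≫ (α_ a (b ⊗ c) d).hom ≫ (𝟙 a ⊗ₘ (α_ b c d).hom) =
      (α_ (a ⊗ b) c d).hom ≫ (α_ a b (c ⊗ d)).hom := by
  simp [MonoidalCategory.pentagon]

theorem triangle_tensorHom (a b : C) :
    (α_ a (𝟙_ C) b).hom ≫ (𝟙 a ⊗ₘ (λ_ b).hom) = (ρ_ a).hom ⊗ₘ 𝟙 b := by
  simp [MonoidalCategory.triangle]

theorem id_tensorHom_comp_leftUnitor {a b : C} (f : a ⟶ b) :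
    (𝟙 (𝟙_ C) ⊗ₘ f) ≫ (λ_ b).hom = (λ_ a).hom ≫ f := by
  simp

theorem tensorHom_id_comp_rightUnitor {a b : C} (f : a ⟶ b) :
    (f ⊗ₘ 𝟙 (𝟙_ C)) ≫ (ρ_ b).hom = (ρ_ a).hom ≫ f := by
  simp

/-- This and the next two lemmas dispose of the sides in the laws for `χ` and `μ`, whose own sides
are identities. -/
theorem id_comp_id_comp_tensorHom_id (a b : C) :
    𝟙 (a ⊗ b) ≫ 𝟙 (a ⊗ b) ≫ (𝟙 a ⊗ₘ 𝟙 b) = 𝟙 (a ⊗ b) := by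
  simp

theorem id_comp_id_tensorHom_id_comp {a b c : C} (f : a ⊗ b ⟶ c) :
    𝟙 (a ⊗ b) ≫ (𝟙 a ⊗ₘ 𝟙 b) ≫ f = f := by
  simp

theorem comp_id_comp_id_tensorHom_id {a b c : C} (f : c ⟶ a ⊗ b) :
    f ≫ 𝟙 (a ⊗ b) ≫ (𝟙 a ⊗ₘ 𝟙 b) = f := by
  simp

end CategoryTheory.MonoidalCategory

/-! ### The symmetric monoidal double category of structured cospans -/

namespace StructuredCospan

variable {A : Type u₀} [Category.{v₀} A] {X : Type u₁} [Category.{v₁} X] {L : A ⥤ X}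
  [HasFiniteColimits X] [HasFiniteCoproducts A] [L.IsLeftAdjoint]

attribute [local instance] monoidalOfHasFiniteCoproducts symmetricOfHasFiniteCoproducts

/-- The associator of the tensor product of structured cospans. -/
noncomputable def tensorAssoc {a b a' b' a'' b'' : A} (M : StructuredCospan L a b)
    (N : StructuredCospan L a' b') (P : StructuredCospan L a'' b'') :
    Hom L (α_ a a' a'').hom (α_ b b' b'').hom
      ((tensor L).hor ((tensor L).hor M N) P) ((tensor L).hor M ((tensor L).hor N P)) where
  map := (coprod.associator M.apex N.apex P.apex).hom
  inp_comm := inv_coprodComparison_associator M.inp N.inp P.inp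
  out_comm := inv_coprodComparison_associator M.out N.out P.out

variable (L) in
/-- A left adjoint sends the initial object to an initial object. -/
noncomputable def isInitialObj : IsInitial (L.obj (⊥_ A)) :=
  initialIsInitial.isInitialObj L _

/-- The left unitor of the tensor product of structured cospans. -/
noncomputable def tensorLeft {a b : A} (M : StructuredCospan L a b) :
    Hom L (λ_ a).hom (λ_ b).hom ((tensor L).hor ((horizontal L).unit (𝟙_ A)) M) M where
  map := coprod.desc ((isInitialObj L).to M.apex) (𝟙 M.apex)
  inp_comm := inv_coprodComparison_leftUnitor initialIsInitial (isInitialObj L) M.inp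
  out_comm := inv_coprodComparison_leftUnitor initialIsInitial (isInitialObj L) M.out

/-- The right unitor of the tensor product of structured cospans. -/
noncomputable def tensorRight {a b : A} (M : StructuredCospan L a b) :
    Hom L (ρ_ a).hom (ρ_ b).hom ((tensor L).hor M ((horizontal L).unit (𝟙_ A))) M where
  map := coprod.desc (𝟙 M.apex) ((isInitialObj L).to M.apex)
  inp_comm := inv_coprodComparison_rightUnitor initialIsInitial (isInitialObj L) M.inp
  out_comm := inv_coprodComparison_rightUnitor initialIsInitial (isInitialObj L) M.out

/-- The braiding of the tensor product of structured cospans. -/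
noncomputable def braid {a b a' b' : A} (M : StructuredCospan L a b)
    (N : StructuredCospan L a' b') :
    Hom L (β_ a a').hom (β_ b b').hom ((tensor L).hor M N) ((tensor L).hor N M) where
  map := (coprod.braiding M.apex N.apex).hom
  inp_comm := inv_coprodComparison_braiding M.inp N.inp
  out_comm := inv_coprodComparison_braiding M.out N.out

/-- The interchange of the composition and the tensor product of structured cospans. -/
noncomputable def interchange {a b c a' b' c' : A} (M₁ : StructuredCospan L a b)
    (N₁ : StructuredCospan L a' b') (M₂ : StructuredCospan L b c)
    (N₂ : StructuredCospan L b' c') : Hom L (𝟙 (a ⊗ a')) (𝟙 (c ⊗ c'))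
      ((horizontal L).comp ((tensor L).hor M₁ N₁) ((tensor L).hor M₂ N₂))
      ((tensor L).hor ((horizontal L).comp M₁ M₂) ((horizontal L).comp N₁ N₂)) where
  map := (pushout.coprodIso M₁.out M₂.inp N₁.out N₂.inp (inv (coprodComparison L b b'))).hom
  inp_comm := by simp [horizontal, tensor, pushout.inl_coprodIso_hom]
  out_comm := by simp [horizontal, tensor, pushout.inr_coprodIso_hom]

variable (L) in
/-- The comparison of the unit cospan on a coproduct with the coproduct of unit cospans. -/
noncomputable def unitComparison (a b : A) : Hom L (𝟙 (a ⊗ b)) (𝟙 (a ⊗ b))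
    ((horizontal L).unit (a ⊗ b))
    ((tensor L).hor ((horizontal L).unit a) ((horizontal L).unit b)) where
  map := (inv (coprodComparison L a b) : L.obj (a ⨿ b) ⟶ L.obj a ⨿ L.obj b)
  inp_comm := by simp [horizontal, tensor]
  out_comm := by simp [horizontal, tensor]

theorem tensorAssoc_isIso {a b a' b' a'' b'' : A} (M : StructuredCospan L a b)
    (N : StructuredCospan L a' b') (P : StructuredCospan L a'' b'') :
    IsIso ((cells L).arr (tensorAssoc M N P)) :=
  isIso_arr (tensorAssoc M N P)
    (inferInstanceAs (IsIso (coprod.associator M.apex N.apex P.apex).hom))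

theorem tensor_hexagon_reverse {a b a' b' a'' b'' : A} (M : StructuredCospan L a b)
    (N : StructuredCospan L a' b') (P : StructuredCospan L a'' b'')
    [IsIso ((cells L).arr (tensorAssoc M P N))] [IsIso ((cells L).arr (tensorAssoc M N P))]
    [IsIso ((cells L).arr (tensorAssoc P M N))] :
    (cells L).arr ((tensor L).sq ((cells L).vId M) (braid N P)) ≫
        inv ((cells L).arr (tensorAssoc M P N)) ≫
        (cells L).arr ((tensor L).sq (braid M P) ((cells L).vId N)) =
      inv ((cells L).arr (tensorAssoc M N P)) ≫
        (cells L).arr (braid ((tensor L).hor M N) P) ≫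
        inv ((cells L).arr (tensorAssoc P M N)) := by
  apply arr_ext
  -- Functors preserve inverses, so whatever inverse 2-morphisms occur, their sides and apex maps
  -- are inverses of ordinary associators.
  · simp only [Functor.map_comp, Functor.map_inv]
    exact hexagon_reverse_tensorHom a a' a''
  · simp only [Functor.map_comp, Functor.map_inv]
    exact hexagon_reverse_tensorHom b b' b''
  · simp only [Functor.map_comp, Functor.map_inv]
    exact hexagon_reverse_tensorHom M.apex N.apex P.apex

variable (L) in
/-- The symmetric monoidal double category of structured cospans. -/
noncomputable def symmetricMonoidalDoubleCategory :
    SymmetricMonoidalDoubleCategory (cells L) (horizontal L) (tensor L) where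
  toDoubleCategory := doubleCategory L
  tensor_id _ _ := arr_ext (id_tensorHom_id _ _) (id_tensorHom_id _ _) coprod.map_id_id
  tensor_comp _ _ _ _ := arr_ext (tensorHom_comp_tensorHom _ _ _ _).symm
    (tensorHom_comp_tensorHom _ _ _ _).symm (coprod.map_map _ _ _ _).symm
  tAssoc := tensorAssoc
  tAssoc_isIso := tensorAssoc_isIso
  tAssoc_natural μ μ' μ'' := arr_ext (associator_naturality _ _ _) (associator_naturality _ _ _)
    (coprod.associator_naturality μ.map μ'.map μ''.map)
  tLeft := tensorLeft
  tLeft_isIso M := isIso_arr (tensorLeft M) ((isInitialObj L).isIso_coprod_desc_left _)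
  tLeft_natural μ := arr_ext (id_tensorHom_comp_leftUnitor _) (id_tensorHom_comp_leftUnitor _)
    ((isInitialObj L).coprod_map_comp_desc_left μ.map)
  tRight := tensorRight
  tRight_isIso M := isIso_arr (tensorRight M) ((isInitialObj L).isIso_coprod_desc_right _)
  tRight_natural μ := arr_ext (tensorHom_id_comp_rightUnitor _) (tensorHom_id_comp_rightUnitor _)
    ((isInitialObj L).coprod_map_comp_desc_right μ.map)
  tPentagon M N P Q := arr_ext (pentagon_tensorHom _ _ _ _) (pentagon_tensorHom _ _ _ _)
    (coprod.pentagon M.apex N.apex P.apex Q.apex)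
  tTriangle M N := arr_ext (triangle_tensorHom _ _) (triangle_tensorHom _ _)
    ((isInitialObj L).coprod_triangle M.apex N.apex)
  braid := braid
  braid_natural μ μ' := arr_ext (BraidedCategory.braiding_naturality _ _)
    (BraidedCategory.braiding_naturality _ _) (BraidedCategory.braiding_naturality μ.map μ'.map)
  braid_symm M N := arr_ext (SymmetricCategory.symmetry _ _) (SymmetricCategory.symmetry _ _)
    (coprod.symmetry M.apex N.apex)
  hexagon_forward M N P := arr_ext (hexagon_forward_tensorHom _ _ _)
    (hexagon_forward_tensorHom _ _ _) (hexagon_forward_tensorHom M.apex N.apex P.apex)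
  hexagon_reverse M N P :=
    have := tensorAssoc_isIso M P N
    have := tensorAssoc_isIso M N P
    have := tensorAssoc_isIso P M N
    tensor_hexagon_reverse M N P
  χ := interchange
  χ_isIso M₁ N₁ M₂ N₂ := isIso_arr (interchange M₁ N₁ M₂ N₂)
    (inferInstanceAs (IsIso (pushout.coprodIso _ _ _ _ _).hom))
  χ_natural μ₁ ν₁ μ₂ ν₂ := arr_ext (comp_id_eq_id_comp _) (comp_id_eq_id_comp _)
    (pushout.map_comp_coprodIso_hom μ₁.out_comm μ₂.inp_comm ν₁.out_comm ν₂.inp_comm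
      -- The tensored 2-morphisms supply the compatibility with the comparison isomorphisms of the
      -- feet.
      ((tensor L).sq μ₁ ν₁).out_comm ((tensor L).sq μ₂ ν₂).inp_comm)
  μ := unitComparison L
  μ_isIso a b := isIso_arr (unitComparison L a b)
    (inferInstanceAs (IsIso (inv (coprodComparison L a b))))
  μ_natural f g := arr_ext (comp_id_eq_id_comp _) (comp_id_eq_id_comp _)
    (coprodComparison_inv_natural L f g).symm
  χ_assoc M₁ N₁ M₂ N₂ M₃ N₃ := arr_ext
    (congrArg (𝟙 _ ≫ 𝟙 _ ≫ ·) (id_tensorHom_id _ _))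
    (congrArg (𝟙 _ ≫ 𝟙 _ ≫ ·) (id_tensorHom_id _ _))
    (pushout.coprodIso_assoc M₁.out M₂.inp M₂.out M₃.inp N₁.out N₂.inp N₂.out N₃.inp _ _)
  χ_leftUnitor M N := arr_ext (id_comp_id_comp_tensorHom_id _ _) (id_comp_id_comp_tensorHom_id _ _)
    (pushout.coprodIso_leftUnitor M.inp N.inp _)
  χ_rightUnitor M N := arr_ext (id_comp_id_comp_tensorHom_id _ _)
    (id_comp_id_comp_tensorHom_id _ _) (pushout.coprodIso_rightUnitor M.out N.out _)
  tAssoc_χ M₁ N₁ P₁ M₂ N₂ P₂ := arr_ext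
    ((id_comp_id_tensorHom_id_comp _).trans (comp_id_comp_id_tensorHom_id _).symm)
    ((id_comp_id_tensorHom_id_comp _).trans (comp_id_comp_id_tensorHom_id _).symm)
    (pushout.coprodIso_associator M₁.out M₂.inp N₁.out N₂.inp P₁.out P₂.inp _ _ _ _ _
      (tensorAssoc M₁ N₁ P₁).out_comm (tensorAssoc M₂ N₂ P₂).inp_comm)
  tAssoc_μ a b c := arr_ext
    ((id_comp_id_tensorHom_id_comp _).trans (comp_id_comp_id_tensorHom_id _).symm)
    ((id_comp_id_tensorHom_id_comp _).trans (comp_id_comp_id_tensorHom_id _).symm)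
    (inv_coprodComparison_associator_id a b c)
  tLeft_χ M N := arr_ext (id_comp_id_tensorHom_id_comp _) (id_comp_id_tensorHom_id_comp _)
    -- On the unit cospan of the initial object, the left unitor of horizontal composition is the
    -- codiagonal-like map `pushout.desc (𝟙 _) (𝟙 _)`, which is the form expected here.
    (pushout.coprodIso_leftUnit (isInitialObj L) M.out N.inp _ _
      (tensorLeft M).out_comm (tensorLeft N).inp_comm)
  tLeft_μ _ := arr_ext (Category.id_comp _) (Category.id_comp _)
    (inv_coprodComparison_leftUnitor_id initialIsInitial (isInitialObj L))
  tRight_χ M N := arr_ext (id_comp_id_tensorHom_id_comp _) (id_comp_id_tensorHom_id_comp _)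
    (pushout.coprodIso_rightUnit (isInitialObj L) M.out N.inp _ _
      (tensorRight M).out_comm (tensorRight N).inp_comm)
  tRight_μ _ := arr_ext (Category.id_comp _) (Category.id_comp _)
    (inv_coprodComparison_rightUnitor_id initialIsInitial (isInitialObj L))
  braid_χ M₁ N₁ M₂ N₂ := arr_ext (comp_id_eq_id_comp _).symm (comp_id_eq_id_comp _).symm
    (pushout.coprodIso_braiding M₁.out M₂.inp N₁.out N₂.inp _ _ _
      (braid M₁ N₁).out_comm (braid M₂ N₂).inp_comm)
  braid_μ a b := arr_ext (comp_id_eq_id_comp _).symm (comp_id_eq_id_comp _).symm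
    (inv_coprodComparison_braiding_id a b)

variable (L) in
/-- The symmetric monoidal double category of structured cospans, with its canonical structure
isomorphisms. -/
noncomputable def symmMonDoubleCat : SymmMonDoubleCat L where
  toSymmetricMonoidalDoubleCategory := symmetricMonoidalDoubleCategory L
  assoc_inl_inl _ _ _ := inl_inl_pushoutAssoc_hom _ _ _ _
  assoc_inr_inl _ _ _ := inr_inl_pushoutAssoc_hom _ _ _ _
  assoc_inr _ _ _ := inr_pushoutAssoc_hom _ _ _ _
  leftUnitor_inl _ := pushout.inl_desc _ _ _
  leftUnitor_inr _ := pushout.inr_desc _ _ _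
  rightUnitor_inl _ := pushout.inl_desc _ _ _
  rightUnitor_inr _ := pushout.inr_desc _ _ _
  tAssoc_map _ _ _ := rfl
  tLeft_inr _ := coprod.inr_desc _ _
  tRight_inl _ := coprod.inl_desc _ _
  braid_map _ _ := rfl
  χ_inl _ _ _ _ := pushout.inl_coprodIso_hom _ _ _ _ _
  χ_inr _ _ _ _ := pushout.inr_coprodIso_hom _ _ _ _ _
  μ_map _ _ := rfl

end StructuredCospan

theorem mainTheorem2 :
    ∃ (_ : HasFiniteColimits CMC.{u}) (_ : freeOnSet.{u}.IsLeftAdjoint),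
      Nonempty (StructuredCospan.SymmMonDoubleCat freeOnSet.{u}) :=
  ⟨CMC.hasFiniteColimits, freeOnSet_isLeftAdjoint,
    have := CMC.hasFiniteColimits
    ⟨StructuredCospan.symmMonDoubleCat freeOnSet⟩⟩
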